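/- **Setting.** Let $A\in\mathbb{R}^{n\times n}$, $B\in\mathbb{R}^{n\times l}$ with $(A,B)$ stabilizable, let $Q\in\mathbb{R}^{n\times n}$ be symmetric positive semidefinite and $R\in\mathbb{R}^{l\times l}$ symmetric positive definite, and let $(A,Q^{1/2})$ be detectable. On a probability space $(\Omega,\mathcal F,\mathbb P)$ let $W(k)\sim\mathcal N(0,\Sigma_W)$, $k\in\mathbb N_0$, be i.i.d. Gaussian random vectors in $\mathbb{R}^n$ (with $\Sigma_W$ positive semidefinite), and let $X_0\sim\mathcal N(\mu_0,\Sigma_0)$ be independent of the sequence $W(\cdot)$. For a control $U(\cdot)$ let $X_U(\cdot,X_0)$ be defined by $$X(k+1)=AX(k)+BU(k)+W(k),\qquad X(0)=X_0,$$ and put $$J_N(X_0,U)=\sum_{k=0}^{N-1}\mathbb E\left[X_U(k,X_0)^TQX_U(k,X_0)+U(k)^TRU(k)\right].$$ Let $\mathcal U$ be the set of all controls $U(\cdot)$ such that, for all $k\in\mathbb N_0$, $U(k)\in L^2(\Omega,\mathcal F_k,\mathbb P;\mathbb R^l)$ with $\mathcal F_k=\sigma(X_U(0,X_0),\dots,X_U(k,X_0))$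 (measurability being understood up to null sets), and such that there is $\alpha>0$ with $\mathbb E[\|X_U(k,X_0)\|^2]\le\alpha$ for all $k\in\mathbb N_0$. Two controls are identified if they agree almost surely at every time $k$. A control $U^*(\cdot)\in\mathcal U$ is called *overtaking optimal* on $\mathcal U$ if for every $U(\cdot)\in\mathcal U$ with $U(\cdot)\ne U^*(\cdot)$ there is a time $N_0$ such that $J_N(X_0,U^*)<J_N(X_0,U)$ for all $N>N_0$. **Theorem.** The discrete-time algebraic Riccati equation $$P=A^TPA+Q-A^TPB\,[R+B^TPB]^{-1}B^TPA$$ has exactly one symmetric positive semidefinite solution $P$, and $P$ is positive definite if $(A,Q^{1/2})$ is observable. Set $K:=-[R+B^TPB]^{-1}B^TPA$. For every initial condition $X_0\sim\mathcal N(\mu_0,\Sigma_0)$ as above there is a unique overtaking optimal control $U^*(\cdot)$ on $\mathcal U$, and it is given by the feedback law $$U^*(k)=KX^*(k),\qquad X^*(\cdot)=X_{U^*}(\cdot,X_0).$$ Moreover, for every $U(\cdot)\in\mathcal U$ with $U(\cdot)\neq U^*(\cdot)$ there are a time $N_0$ and an $\varepsilon>0$ such that $$J_N(X_0,U^*)+\varepsilon<J_N(X_0,U)\qquad\text{for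 all }N\ge N_0.$$ -/

import Mathlib

open MeasureTheory ProbabilityTheory
open scoped Matrix MatrixOrder

namespace StochasticLQ

noncomputable section

/-- A real square matrix is Schur stable if all its complex eigenvalues have modulus `< 1`. -/
def IsSchurStable {n : ℕ} (M : Matrix (Fin n) (Fin n) ℝ) : Prop :=
  ∀ z ∈ spectrum ℂ (M.map (algebraMap ℝ ℂ)), ‖z‖ < 1

/-- `(A, B)` is stabilizable. -/
def IsStabilizable {n l : ℕ} (A : Matrix (Fin n) (Fin n) ℝ) (B : Matrix (Fin n) (Fin l) ℝ) :
    Prop :=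
  ∃ F : Matrix (Fin l) (Fin n) ℝ, IsSchurStable (A + B * F)

/-- `(A, C)` is detectable. -/
def IsDetectable {n m : ℕ} (A : Matrix (Fin n) (Fin n) ℝ) (C : Matrix (Fin m) (Fin n) ℝ) :
    Prop :=
  ∃ L : Matrix (Fin n) (Fin m) ℝ, IsSchurStable (A + L * C)

/-- `(A, C)` is observable: only the zero state produces the zero output sequence. -/
def IsObservable {n m : ℕ} (A : Matrix (Fin n) (Fin n) ℝ) (C : Matrix (Fin m) (Fin n) ℝ) :
    Prop :=
  ∀ x : Fin n → ℝ, (∀ k : ℕ, (C * A ^ k) *ᵥ x = 0) → x = 0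

/-- `P` solves the discrete-time algebraic Riccati equation. -/
def SolvesRiccati {n l : ℕ} (A : Matrix (Fin n) (Fin n) ℝ) (B : Matrix (Fin n) (Fin l) ℝ)
    (Q : Matrix (Fin n) (Fin n) ℝ) (R : Matrix (Fin l) (Fin l) ℝ)
    (P : Matrix (Fin n) (Fin n) ℝ) : Prop :=
  P = Aᵀ * P * A + Q - Aᵀ * P * B * (R + Bᵀ * P * B)⁻¹ * (Bᵀ * P * A)

/-- The gain `K = -(R + Bᵀ P B)⁻¹ Bᵀ P A`. -/
def gain {n l : ℕ} (A : Matrix (Fin n) (Fin n) ℝ) (B : Matrix (Fin n) (Fin l) ℝ)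
    (R : Matrix (Fin l) (Fin l) ℝ) (P : Matrix (Fin n) (Fin n) ℝ) : Matrix (Fin l) (Fin n) ℝ :=
  -((R + Bᵀ * P * B)⁻¹ * Bᵀ * P * A)

/-- The weighted squared norm `‖x‖_M² = xᵀ M x`. -/
def weightedSq {m : ℕ} (M : Matrix (Fin m) (Fin m) ℝ) (x : EuclideanSpace ℝ (Fin m)) : ℝ :=
  inner ℝ x (Matrix.toEuclideanLin M x)

variable {Ω : Type*} {n l : ℕ}

/-- The state process `X_U(·, X₀)`: `X(0) = X₀`, `X(k+1) = A X(k) + B U(k) + W(k)`. -/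
def state (A : Matrix (Fin n) (Fin n) ℝ) (B : Matrix (Fin n) (Fin l) ℝ)
    (W : ℕ → Ω → EuclideanSpace ℝ (Fin n)) (X₀ : Ω → EuclideanSpace ℝ (Fin n))
    (U : ℕ → Ω → EuclideanSpace ℝ (Fin l)) : ℕ → Ω → EuclideanSpace ℝ (Fin n)
  | 0, ω => X₀ ω
  | k + 1, ω =>
    Matrix.toEuclideanLin A (state A B W X₀ U k ω) + Matrix.toEuclideanLin B (U k ω) + W k ω

/-- The history σ-algebra `σ(X(0), …, X(k))` of a process `X`. -/
abbrev history (X : ℕ → Ω → EuclideanSpace ℝ (Fin n)) (k : ℕ) : MeasurableSpace Ω :=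
  MeasurableSpace.comap (fun ω (j : Set.Iic k) => X j ω) inferInstance

variable [MeasurableSpace Ω]

/-- The stage cost `ℓ(X, U) = 𝔼[‖X‖_Q² + ‖U‖_R²]`. -/
def stageCost (Pr : Measure Ω) (Q : Matrix (Fin n) (Fin n) ℝ) (R : Matrix (Fin l) (Fin l) ℝ)
    (X : Ω → EuclideanSpace ℝ (Fin n)) (U : Ω → EuclideanSpace ℝ (Fin l)) : ℝ :=
  ∫ ω, (weightedSq Q (X ω) + weightedSq R (U ω)) ∂Pr

/-- The cost `J_N(X₀, U)` over the horizon `N`. -/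
def cost (Pr : Measure Ω) (A : Matrix (Fin n) (Fin n) ℝ) (B : Matrix (Fin n) (Fin l) ℝ)
    (Q : Matrix (Fin n) (Fin n) ℝ) (R : Matrix (Fin l) (Fin l) ℝ)
    (W : ℕ → Ω → EuclideanSpace ℝ (Fin n)) (X₀ : Ω → EuclideanSpace ℝ (Fin n))
    (N : ℕ) (U : ℕ → Ω → EuclideanSpace ℝ (Fin l)) : ℝ :=
  ∑ k ∈ Finset.range N, stageCost Pr Q R (state A B W X₀ U k) (U k)

/-- The set `𝒰` of admissible controls: `U(k)` is square integrable and (up to a null set, as for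
an element of `L²(Ω, 𝓕_k, Pr)`) measurable with respect to `𝓕_k = σ(X_U(0), …, X_U(k))`, and the
second moments of the resulting state are bounded uniformly in time. -/
def admissible (Pr : Measure Ω) (A : Matrix (Fin n) (Fin n) ℝ) (B : Matrix (Fin n) (Fin l) ℝ)
    (W : ℕ → Ω → EuclideanSpace ℝ (Fin n)) (X₀ : Ω → EuclideanSpace ℝ (Fin n)) :
    Set (ℕ → Ω → EuclideanSpace ℝ (Fin l)) :=
  {U | (∀ k, MemLp (U k) 2 Pr ∧
          AEStronglyMeasurable[history (state A B W X₀ U) k] (U k) Pr) ∧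
       ∃ α : ℝ, 0 < α ∧ ∀ k, ∫ ω, ‖state A B W X₀ U k ω‖ ^ 2 ∂Pr ≤ α}

/-- Equality of controls as sequences of elements of `L²`. -/
def SameControl (Pr : Measure Ω) (U V : ℕ → Ω → EuclideanSpace ℝ (Fin l)) : Prop :=
  ∀ k, U k =ᵐ[Pr] V k

/-- `U₁` overtakes `U₂` for the family of costs `J N`: `J N U₁ < J N U₂` for all `N > N₀`. -/
def Overtakes (J : ℕ → (ℕ → Ω → EuclideanSpace ℝ (Fin l)) → ℝ)
    (U₁ U₂ : ℕ → Ω → EuclideanSpace ℝ (Fin l)) : Prop :=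
  ∃ N₀ : ℕ, ∀ N : ℕ, N₀ < N → J N U₁ < J N U₂

/-- `U` belongs to `𝒰` and overtakes every other control of `𝒰`. -/
def IsOvertakingOptimal (Pr : Measure Ω) (J : ℕ → (ℕ → Ω → EuclideanSpace ℝ (Fin l)) → ℝ)
    (𝒰 : Set (ℕ → Ω → EuclideanSpace ℝ (Fin l))) (U : ℕ → Ω → EuclideanSpace ℝ (Fin l)) : Prop :=
  U ∈ 𝒰 ∧ ∀ V ∈ 𝒰, ¬ SameControl Pr V U → Overtakes J U V

end

end StochasticLQ

/-! Completing the square in the one-step cost (`weightedSq_riccatiMap`) shows that a solution `P`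
of the Riccati equation turns the stage cost into a difference of values of `P` plus a square, in
the weight `R + Bᵀ P B`, of the deviation of the control from the feedback `K x`. An admissible
control depends only on the past noise, so the centred `W k` is independent of everything else that
enters `X (k+1)` and contributes a term free of the control. Summing (`cost_eq`), the cost is a
constant of the control, minus the terminal value `𝔼 ‖X N‖_P²`, plus the accumulated `excess`. The
excess is nonnegative, and vanishes at all times only for the feedback control, up to null sets.

It remains to control the terminal values (`exists_pos_eventually_lt_sum_add_sub`). If the excess is
not summable, it outgrows the bounded terminal values. If it is summable, stability of `A + B K`
drives the two state processes together in mean square, so the terminal value of the competitor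
eventually exceeds that of the feedback by less than any given amount, while one positive excess
term persists. Either way a fixed margin remains, and uniqueness follows because two distinct
optimal controls would overtake each other.

The Riccati solution is the limit of value iteration from `0`, which increases and is bounded by the
cost of a stabilizing feedback (`exists_solvesRiccati`). Detectability makes the closed loop of
every positive semidefinite solution stable (`SolvesRiccati.isPowerStable`), and comparing two
solutions along a stable closed loop gives uniqueness. -/

namespace StochasticLQ

/-! ### Quadratic forms of real matrices -/

section QuadraticForms

variable {n m l : ℕ}

theorem weightedSq_eq_dotProduct (M : Matrix (Fin m) (Fin m) ℝ) (x : EuclideanSpace ℝ (Fin m)) :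
    weightedSq M x = x.ofLp ⬝ᵥ (M *ᵥ x.ofLp) := by
  simp [weightedSq, EuclideanSpace.inner_eq_star_dotProduct, dotProduct_comm]

theorem weightedSq_nonneg {M : Matrix (Fin m) (Fin m) ℝ} (hM : M.PosSemidef)
    (x : EuclideanSpace ℝ (Fin m)) : 0 ≤ weightedSq M x := by
  rw [weightedSq_eq_dotProduct]
  simpa using hM.dotProduct_mulVec_nonneg x.ofLp

theorem weightedSq_pos {M : Matrix (Fin m) (Fin m) ℝ} (hM : M.PosDef)
    {x : EuclideanSpace ℝ (Fin m)} (hx : x ≠ 0) : 0 < weightedSq M x := by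
  rw [weightedSq_eq_dotProduct]
  have : x.ofLp ≠ 0 := fun h => hx (by ext i; simp [h])
  simpa using hM.dotProduct_mulVec_pos this

theorem weightedSq_zero_left (x : EuclideanSpace ℝ (Fin m)) :
    weightedSq (0 : Matrix (Fin m) (Fin m) ℝ) x = 0 := by
  simp [weightedSq]

theorem continuous_weightedSq (M : Matrix (Fin m) (Fin m) ℝ) : Continuous (weightedSq M) := by
  unfold weightedSq
  exact continuous_id.inner (LinearMap.continuous_of_finiteDimensional _)

theorem toEuclideanLin_mul (M : Matrix (Fin n) (Fin m) ℝ) (N : Matrix (Fin m) (Fin l) ℝ)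
    (x : EuclideanSpace ℝ (Fin l)) :
    Matrix.toEuclideanLin (M * N) x = Matrix.toEuclideanLin M (Matrix.toEuclideanLin N x) := by
  ext i
  simp

theorem toEuclideanLin_pow_succ (M : Matrix (Fin n) (Fin n) ℝ) (k : ℕ)
    (x : EuclideanSpace ℝ (Fin n)) :
    Matrix.toEuclideanLin (M ^ (k + 1)) x =
      Matrix.toEuclideanLin M (Matrix.toEuclideanLin (M ^ k) x) := by
  rw [pow_succ', toEuclideanLin_mul]

theorem exists_norm_toEuclideanLin_le (M : Matrix (Fin n) (Fin m) ℝ) :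
    ∃ c : ℝ, 0 < c ∧ ∀ x, ‖Matrix.toEuclideanLin M x‖ ≤ c * ‖x‖ := by
  let T := LinearMap.toContinuousLinearMap (Matrix.toEuclideanLin M)
  refine ⟨‖T‖ + 1, by positivity, fun x => ?_⟩
  calc ‖Matrix.toEuclideanLin M x‖ = ‖T x‖ := rfl
    _ ≤ ‖T‖ * ‖x‖ := T.le_opNorm x
    _ ≤ _ := by nlinarith [norm_nonneg x]

theorem exists_abs_weightedSq_le (M : Matrix (Fin m) (Fin m) ℝ) :
    ∃ c : ℝ, 0 < c ∧ ∀ x, |weightedSq M x| ≤ c * ‖x‖ ^ 2 := by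
  obtain ⟨c, hc, h⟩ := exists_norm_toEuclideanLin_le M
  refine ⟨c, hc, fun x => (abs_real_inner_le_norm _ _).trans ?_⟩
  nlinarith [h x, norm_nonneg x]

theorem norm_toEuclideanLin_sqrt_sq {M : Matrix (Fin m) (Fin m) ℝ} (hM : M.PosSemidef)
    (x : EuclideanSpace ℝ (Fin m)) :
    ‖Matrix.toEuclideanLin (CFC.sqrt M) x‖ ^ 2 = weightedSq M x := by
  have hs : (CFC.sqrt M).IsHermitian := (Matrix.nonneg_iff_posSemidef.mp (CFC.sqrt_nonneg M)).isHermitian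
  have hsym := Matrix.isSymmetric_toEuclideanLin_iff.mpr hs
  rw [← real_inner_self_eq_norm_sq, hsym, ← toEuclideanLin_mul,
    CFC.sqrt_mul_sqrt_self _ hM.nonneg, weightedSq]

/-- The square root of a positive definite matrix is invertible, so `‖x‖` is bounded by a multiple
of `‖√M x‖`, whose square is the form. -/
theorem exists_le_weightedSq {M : Matrix (Fin m) (Fin m) ℝ} (hM : M.PosDef) :
    ∃ r : ℝ, 0 < r ∧ ∀ x, r * ‖x‖ ^ 2 ≤ weightedSq M x := by
  have hs : IsUnit (CFC.sqrt M).det := by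
    have h := CFC.sqrt_mul_sqrt_self M hM.posSemidef.nonneg
    have hd := hM.det_pos
    rw [← h, Matrix.det_mul] at hd
    exact isUnit_iff_ne_zero.mpr fun h0 => by simp [h0] at hd
  obtain ⟨c, hc, h⟩ := exists_norm_toEuclideanLin_le (CFC.sqrt M)⁻¹
  refine ⟨(c ^ 2)⁻¹, by positivity, fun x => ?_⟩
  rw [← norm_toEuclideanLin_sqrt_sq hM.posSemidef, inv_mul_le_iff₀ (by positivity), ← mul_pow]
  have := h (Matrix.toEuclideanLin (CFC.sqrt M) x)
  rw [← toEuclideanLin_mul, Matrix.nonsing_inv_mul _ hs] at this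
  simp only [Matrix.toLpLin_one, LinearMap.id_apply] at this
  gcongr

theorem inner_toEuclideanLin_comm {M : Matrix (Fin m) (Fin m) ℝ} (hM : M.IsHermitian)
    (x y : EuclideanSpace ℝ (Fin m)) :
    inner ℝ x (Matrix.toEuclideanLin M y) = inner ℝ y (Matrix.toEuclideanLin M x) := by
  rw [← Matrix.isSymmetric_toEuclideanLin_iff.mpr hM x y, real_inner_comm]

theorem weightedSq_add {M : Matrix (Fin m) (Fin m) ℝ} (hM : M.IsHermitian)
    (x y : EuclideanSpace ℝ (Fin m)) :
    weightedSq M (x + y) =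
      weightedSq M x + 2 * inner ℝ (Matrix.toEuclideanLin M x) y + weightedSq M y := by
  have h := inner_toEuclideanLin_comm hM x y
  simp only [weightedSq, map_add, inner_add_left, inner_add_right, h,
    real_inner_comm (Matrix.toEuclideanLin M x) y]
  ring

/-- Young's inequality for the square of a sum in a positive semidefinite quadratic form. -/
theorem weightedSq_add_le {M : Matrix (Fin m) (Fin m) ℝ} (hM : M.PosSemidef) {t : ℝ} (ht : 0 < t)
    (x y : EuclideanSpace ℝ (Fin m)) :
    weightedSq M (x + y) ≤ (1 + t) * weightedSq M x + (1 + t⁻¹) * weightedSq M y := by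
  -- Expanding the nonnegative form at `t x - y` and dividing by `t` bounds the cross term.
  have h := weightedSq_nonneg hM (t • x + -y)
  rw [weightedSq_add hM.isHermitian] at h ⊢
  have e1 : weightedSq M (t • x) = t ^ 2 * weightedSq M x := by
    simp only [weightedSq, map_smul, inner_smul_left, inner_smul_right]; simp; ring
  have e2 : weightedSq M (-y) = weightedSq M y := by simp [weightedSq]
  rw [e1, e2, map_smul, inner_smul_left, inner_neg_right] at h
  simp only [conj_trivial] at h
  have h2 : 0 ≤ t⁻¹ * (t ^ 2 * weightedSq M x +
      2 * (t * -inner ℝ (Matrix.toEuclideanLin M x) y) + weightedSq M y) := by positivity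
  have h3 : t⁻¹ * (t ^ 2 * weightedSq M x +
      2 * (t * -inner ℝ (Matrix.toEuclideanLin M x) y) + weightedSq M y) =
      t * weightedSq M x - 2 * inner ℝ (Matrix.toEuclideanLin M x) y + t⁻¹ * weightedSq M y := by
    field_simp
    ring
  linarith

theorem eq_of_weightedSq_eq {M N : Matrix (Fin m) (Fin m) ℝ} (hM : M.IsHermitian)
    (hN : N.IsHermitian) (h : ∀ x, weightedSq M x = weightedSq N x) : M = N := by
  apply Matrix.toEuclideanLin.injective
  refine LinearMap.ext fun x => ext_inner_right ℝ fun y => ?_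
  have := h (x + y)
  rw [weightedSq_add hM, weightedSq_add hN, h x, h y] at this
  linarith

end QuadraticForms

/-! ### The Riccati map and completion of the square -/

section Riccati

variable {n l : ℕ}

/-- The right-hand side of the discrete-time algebraic Riccati equation. -/
noncomputable def riccatiMap (A : Matrix (Fin n) (Fin n) ℝ) (B : Matrix (Fin n) (Fin l) ℝ)
    (Q : Matrix (Fin n) (Fin n) ℝ) (R : Matrix (Fin l) (Fin l) ℝ)
    (P : Matrix (Fin n) (Fin n) ℝ) : Matrix (Fin n) (Fin n) ℝ :=
  Aᵀ * P * A + Q - Aᵀ * P * B * (R + Bᵀ * P * B)⁻¹ * (Bᵀ * P * A)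

variable {A : Matrix (Fin n) (Fin n) ℝ} {B : Matrix (Fin n) (Fin l) ℝ}
  {Q : Matrix (Fin n) (Fin n) ℝ} {R : Matrix (Fin l) (Fin l) ℝ} {P : Matrix (Fin n) (Fin n) ℝ}

theorem posDef_add_transpose_mul_mul (hR : R.PosDef) (hP : P.PosSemidef) :
    (R + Bᵀ * P * B).PosDef := by
  have := hP.conjTranspose_mul_mul_same B
  rw [Matrix.conjTranspose_eq_transpose_of_trivial] at this
  exact hR.add_posSemidef this

/-- Completion of the square in the one-step cost. -/
theorem weightedSq_riccatiMap (hR : R.PosDef) (hP : P.PosSemidef)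
    (x : EuclideanSpace ℝ (Fin n)) (u : EuclideanSpace ℝ (Fin l)) :
    weightedSq Q x + weightedSq R u +
        weightedSq P (Matrix.toEuclideanLin A x + Matrix.toEuclideanLin B u) =
      weightedSq (riccatiMap A B Q R P) x +
        weightedSq (R + Bᵀ * P * B) (u - Matrix.toEuclideanLin (gain A B R P) x) := by
  set S := R + Bᵀ * P * B with hS
  set K := gain A B R P with hK
  have hSpd : S.PosDef := posDef_add_transpose_mul_mul hR hP
  have hSu : IsUnit S.det := hSpd.det_pos.ne'.isUnit
  -- The normal equation of the minimization over `u`; it makes the cross terms on the two sides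
  -- agree.
  have hSK : S * K = -(Bᵀ * P * A) := by
    rw [hK, gain, Matrix.mul_neg, ← hS, Matrix.mul_assoc, Matrix.mul_assoc,
      Matrix.mul_nonsing_inv_cancel_left _ _ hSu, Matrix.mul_assoc]
  have hRic : riccatiMap A B Q R P = Aᵀ * P * A + Q - Kᵀ * S * K := by
    have hST : Sᵀ = S := by
      simpa [Matrix.conjTranspose_eq_transpose_of_trivial] using hSpd.isHermitian.eq
    have hPT : Pᵀ = P := by
      simpa [Matrix.conjTranspose_eq_transpose_of_trivial] using hP.isHermitian.eq
    have h1 : Kᵀ * S = -(Aᵀ * P * B) := by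
      have := congrArg Matrix.transpose hSK
      simpa [Matrix.transpose_mul, hST, hPT, Matrix.mul_assoc] using this
    rw [h1, riccatiMap, hK, gain, ← hS]
    simp [Matrix.mul_assoc]
  have hAdj : ∀ {p q : ℕ} (M : Matrix (Fin p) (Fin q) ℝ) (y : EuclideanSpace ℝ (Fin q))
      (z : EuclideanSpace ℝ (Fin p)),
      inner ℝ y (Matrix.toEuclideanLin Mᵀ z) = inner ℝ (Matrix.toEuclideanLin M y) z := by
    intro p q M y z
    rw [← Matrix.conjTranspose_eq_transpose_of_trivial,
      Matrix.toEuclideanLin_conjTranspose_eq_adjoint, LinearMap.adjoint_inner_right]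
  have hAP : weightedSq (Aᵀ * P * A) x = weightedSq P (Matrix.toEuclideanLin A x) := by
    simp only [weightedSq, toEuclideanLin_mul, hAdj]
  have hBP : weightedSq (Bᵀ * P * B) u = weightedSq P (Matrix.toEuclideanLin B u) := by
    simp only [weightedSq, toEuclideanLin_mul, hAdj]
  have hKS : weightedSq (Kᵀ * S * K) x = weightedSq S (Matrix.toEuclideanLin K x) := by
    simp only [weightedSq, toEuclideanLin_mul, hAdj]
  have hlin : ∀ {p : ℕ} (M N : Matrix (Fin p) (Fin p) ℝ) (y : EuclideanSpace ℝ (Fin p)),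
      weightedSq (M + N) y = weightedSq M y + weightedSq N y := by
    intro p M N y
    simp [weightedSq, inner_add_right]
  have hlin' : weightedSq (Aᵀ * P * A + Q - Kᵀ * S * K) x =
      weightedSq (Aᵀ * P * A) x + weightedSq Q x - weightedSq (Kᵀ * S * K) x := by
    simp [weightedSq, inner_add_right, inner_sub_right]
  have hcross : inner ℝ (Matrix.toEuclideanLin S u) (-Matrix.toEuclideanLin K x) =
      inner ℝ (Matrix.toEuclideanLin P (Matrix.toEuclideanLin A x)) (Matrix.toEuclideanLin B u) := by
    rw [Matrix.isSymmetric_toEuclideanLin_iff.mpr hSpd.isHermitian, map_neg, ← toEuclideanLin_mul,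
      hSK, map_neg, LinearMap.neg_apply, neg_neg, toEuclideanLin_mul, toEuclideanLin_mul, hAdj,
      real_inner_comm]
  have hneg : weightedSq S (-Matrix.toEuclideanLin K x) =
      weightedSq S (Matrix.toEuclideanLin K x) := by simp [weightedSq]
  rw [hRic, hlin', hAP, hKS, sub_eq_add_neg u, weightedSq_add hSpd.isHermitian, hcross, hneg,
    weightedSq_add hP.isHermitian, hS, hlin R _ u, hBP]
  ring

/-- The Riccati map is the one-step minimization over `u`. Comparison arguments use this bound with
a suboptimal input, and `weightedSq_riccatiMap_gain` for the minimizer. -/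
theorem weightedSq_riccatiMap_le (hR : R.PosDef) (hP : P.PosSemidef)
    (x : EuclideanSpace ℝ (Fin n)) (u : EuclideanSpace ℝ (Fin l)) :
    weightedSq (riccatiMap A B Q R P) x ≤ weightedSq Q x + weightedSq R u +
      weightedSq P (Matrix.toEuclideanLin A x + Matrix.toEuclideanLin B u) := by
  rw [weightedSq_riccatiMap hR hP]
  linarith [weightedSq_nonneg (posDef_add_transpose_mul_mul (B := B) hR hP).posSemidef
    (u - Matrix.toEuclideanLin (gain A B R P) x)]

theorem weightedSq_riccatiMap_gain (hR : R.PosDef) (hP : P.PosSemidef)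
    (x : EuclideanSpace ℝ (Fin n)) :
    weightedSq (riccatiMap A B Q R P) x = weightedSq Q x +
      weightedSq R (Matrix.toEuclideanLin (gain A B R P) x) +
      weightedSq P (Matrix.toEuclideanLin (A + B * gain A B R P) x) := by
  have := weightedSq_riccatiMap (A := A) (B := B) (Q := Q) hR hP x
    (Matrix.toEuclideanLin (gain A B R P) x)
  rw [sub_self, ← toEuclideanLin_mul, ← LinearMap.add_apply, ← map_add] at this
  rw [this]
  simp [weightedSq]

theorem isHermitian_riccatiMap (hQ : Q.PosSemidef) (hR : R.PosDef) (hP : P.PosSemidef) :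
    (riccatiMap A B Q R P).IsHermitian := by
  have hQT : Qᵀ = Q := by
    simpa [Matrix.conjTranspose_eq_transpose_of_trivial] using hQ.isHermitian.eq
  have hPT : Pᵀ = P := by
    simpa [Matrix.conjTranspose_eq_transpose_of_trivial] using hP.isHermitian.eq
  have hRT : Rᵀ = R := by
    simpa [Matrix.conjTranspose_eq_transpose_of_trivial] using hR.isHermitian.eq
  rw [Matrix.IsHermitian, Matrix.conjTranspose_eq_transpose_of_trivial, riccatiMap]
  simp [Matrix.transpose_nonsing_inv, Matrix.transpose_mul, hQT, hPT, hRT, Matrix.mul_assoc]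

theorem posSemidef_of_weightedSq_nonneg {M : Matrix (Fin n) (Fin n) ℝ} (hM : M.IsHermitian)
    (h : ∀ x, 0 ≤ weightedSq M x) : M.PosSemidef :=
  Matrix.PosSemidef.of_dotProduct_mulVec_nonneg hM fun x => by
    simpa [weightedSq_eq_dotProduct] using h (WithLp.toLp 2 x)

theorem posSemidef_riccatiMap (hQ : Q.PosSemidef) (hR : R.PosDef) (hP : P.PosSemidef) :
    (riccatiMap A B Q R P).PosSemidef := by
  refine posSemidef_of_weightedSq_nonneg (isHermitian_riccatiMap hQ hR hP) fun x => ?_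
  rw [weightedSq_riccatiMap_gain hR hP]
  have h1 := weightedSq_nonneg hQ x
  have h2 := weightedSq_nonneg hR.posSemidef (Matrix.toEuclideanLin (gain A B R P) x)
  have h3 := weightedSq_nonneg hP (Matrix.toEuclideanLin (A + B * gain A B R P) x)
  linarith

end Riccati

/-! ### Scalar comparison recursions -/

section ScalarRecursion

/-- The solution of the scalar recursion `s (k + 1) = ρ * s k + w k` with `s 0 = a`. -/
noncomputable def scalarRec (ρ a : ℝ) (w : ℕ → ℝ) : ℕ → ℝ
  | 0 => a
  | k + 1 => ρ * scalarRec ρ a w k + w k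

variable {ρ a : ℝ} {w : ℕ → ℝ}

theorem scalarRec_nonneg (hρ : 0 ≤ ρ) (ha : 0 ≤ a) (hw : ∀ k, 0 ≤ w k) (k : ℕ) :
    0 ≤ scalarRec ρ a w k := by
  induction k with
  | zero => exact ha
  | succ k ih =>
    rw [scalarRec]
    have := hw k
    positivity

theorem scalarRec_le_of_le (hρ : 0 ≤ ρ) (hρ1 : ρ < 1) {b : ℝ} (ha : a ≤ b / (1 - ρ))
    (hw : ∀ k, w k ≤ b) (k : ℕ) : scalarRec ρ a w k ≤ b / (1 - ρ) := by
  induction k with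
  | zero => exact ha
  | succ k ih =>
    have h1 : 0 < 1 - ρ := by linarith
    have h2 : b / (1 - ρ) = ρ * (b / (1 - ρ)) + b := by field_simp; ring
    rw [scalarRec, h2]
    gcongr
    exact hw k

theorem sum_scalarRec_le (hρ : 0 ≤ ρ) (hρ1 : ρ < 1) (ha : 0 ≤ a) (hw : ∀ k, 0 ≤ w k) (N : ℕ) :
    ∑ k ∈ Finset.range N, scalarRec ρ a w k ≤
      (1 - ρ)⁻¹ * (a + ∑ k ∈ Finset.range N, w k) := by
  -- Summing the recursion telescopes exactly; the final term is nonnegative and is dropped.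
  have key : ∀ N, (1 - ρ) * ∑ k ∈ Finset.range N, scalarRec ρ a w k + scalarRec ρ a w N =
      a + ∑ k ∈ Finset.range N, w k := by
    intro N
    induction N with
    | zero => simp [scalarRec]
    | succ N ih => rw [Finset.sum_range_succ, Finset.sum_range_succ, scalarRec]; linarith
  rw [le_inv_mul_iff₀ (by linarith), ← key N]
  linarith [scalarRec_nonneg hρ ha hw N]

/-- Convexity of the square, with `ρ s + w` read as the convex combination of `s` and `w / (1 - ρ)`
with weights `ρ` and `1 - ρ`. This passes from norms to squared norms, which can be integrated. -/
theorem scalarRec_sq_le (hρ : 0 ≤ ρ) (hρ1 : ρ < 1) (k : ℕ) :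
    scalarRec ρ a w k ^ 2 ≤ (1 - ρ)⁻¹ * scalarRec ρ (a ^ 2) (fun j => w j ^ 2) k := by
  have h1 : 0 < 1 - ρ := by linarith
  induction k with
  | zero =>
    simp only [scalarRec]
    rw [le_inv_mul_iff₀ h1]
    nlinarith [sq_nonneg a]
  | succ k ih =>
    rw [scalarRec, scalarRec]
    rw [le_inv_mul_iff₀ h1] at ih ⊢
    nlinarith [mul_le_mul_of_nonneg_left ih hρ, mul_nonneg hρ
      (sq_nonneg ((1 - ρ) * scalarRec ρ a w k - w k))]

end ScalarRecursion

/-! ### Geometric decay of matrix powers -/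

section PowerStability

variable {n : ℕ}

/-- The powers of `M` decay geometrically. -/
def IsPowerStable (M : Matrix (Fin n) (Fin n) ℝ) : Prop :=
  ∃ C ρ : ℝ, 0 < C ∧ 0 ≤ ρ ∧ ρ < 1 ∧
    ∀ (k : ℕ) (x : EuclideanSpace ℝ (Fin n)),
      ‖Matrix.toEuclideanLin (M ^ k) x‖ ≤ C * ρ ^ k * ‖x‖

open scoped Matrix.Norms.L2Operator in
-- Gelfand's formula: any `ρ` strictly between the spectral radius and `1` eventually dominates the
-- `k`-th root of `‖M ^ k‖`.
theorem exists_norm_pow_le_of_spectrum [NeZero n] (M : Matrix (Fin n) (Fin n) ℂ)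
    (h : ∀ z ∈ spectrum ℂ M, ‖z‖ < 1) :
    ∃ C ρ : ℝ, 0 < C ∧ 0 ≤ ρ ∧ ρ < 1 ∧ ∀ k : ℕ, ‖M ^ k‖ ≤ C * ρ ^ k := by
  have : CompleteSpace (Matrix (Fin n) (Fin n) ℂ) := FiniteDimensional.complete ℂ _
  have hr : spectralRadius ℂ M < (1 : NNReal) :=
    spectrum.spectralRadius_lt_of_forall_lt M fun z hz => by
      rw [← NNReal.coe_lt_coe]; simpa using h z hz
  obtain ⟨ρ, hρ1, hρ2⟩ := ENNReal.lt_iff_exists_nnreal_btwn.mp hr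
  have hρ0 : 0 < ρ := by
    rw [← ENNReal.coe_pos]; exact lt_of_le_of_lt (zero_le) hρ1
  have hev : ∀ᶠ k : ℕ in Filter.atTop, ‖M ^ k‖ ≤ 1 * ‖(ρ : ℝ) ^ k‖ := by
    filter_upwards [(spectrum.pow_nnnorm_pow_one_div_tendsto_nhds_spectralRadius M).eventually_lt_const
      hρ1, Filter.eventually_gt_atTop 0] with k hk hk0
    have hk0' : (0 : ℝ) < k := by exact_mod_cast hk0
    rw [one_div, ENNReal.rpow_inv_lt_iff hk0', ENNReal.rpow_natCast, ← ENNReal.coe_pow,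
      ENNReal.coe_lt_coe, ← NNReal.coe_lt_coe] at hk
    rw [one_mul, Real.norm_of_nonneg (pow_nonneg ρ.coe_nonneg k)]
    simpa using hk.le
  -- Enlarging the constant covers the finitely many remaining `k`, since `ρ ^ k` never vanishes.
  obtain ⟨C, hC, hb⟩ := Asymptotics.bound_of_isBigO_nat_atTop (Asymptotics.IsBigO.of_bound 1 hev)
  refine ⟨C, ρ, hC, ρ.2, by exact_mod_cast hρ2, fun k => ?_⟩
  have := hb (x := k) (by positivity)
  rwa [Real.norm_of_nonneg (pow_nonneg ρ.coe_nonneg k)] at this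

open scoped Matrix.Norms.L2Operator in
theorem IsSchurStable.isPowerStable {M : Matrix (Fin n) (Fin n) ℝ} (h : IsSchurStable M) :
    IsPowerStable M := by
  rcases Nat.eq_zero_or_pos n with rfl | hn
  · exact ⟨1, 0, one_pos, le_rfl, one_pos, fun k x => by
      rw [Subsingleton.elim x 0]; simp⟩
  have : NeZero n := ⟨hn.ne'⟩
  obtain ⟨C, ρ, hC, hρ, hρ1, hb⟩ := exists_norm_pow_le_of_spectrum _ h
  refine ⟨C, ρ, hC, hρ, hρ1, fun k x => ?_⟩
  -- The isometric embedding into the complexification transfers the complex bound to real vectors.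
  let ι : ∀ {m : ℕ}, EuclideanSpace ℝ (Fin m) → EuclideanSpace ℂ (Fin m) :=
    fun y => WithLp.toLp 2 fun i => (y i : ℂ)
  have hι : ∀ {m : ℕ} (y : EuclideanSpace ℝ (Fin m)), ‖ι y‖ = ‖y‖ := by
    intro m y
    simp [ι, EuclideanSpace.norm_eq]
  have hmap : M.map (algebraMap ℝ ℂ) ^ k = (M ^ k).map (algebraMap ℝ ℂ) := by
    simpa using (map_pow (algebraMap ℝ ℂ).mapMatrix M k).symm
  have happ : ι (Matrix.toEuclideanLin (M ^ k) x) =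
      WithLp.toLp 2 ((M.map (algebraMap ℝ ℂ) ^ k) *ᵥ (ι x).ofLp) := by
    rw [hmap]
    generalize M ^ k = N
    ext i
    simp [ι, Matrix.mulVec, dotProduct]
  rw [← hι, happ, ← hι x]
  calc _ ≤ ‖M.map (algebraMap ℝ ℂ) ^ k‖ * ‖ι x‖ := by
        simpa using Matrix.l2_opNorm_mulVec (M.map (algebraMap ℝ ℂ) ^ k) (ι x)
    _ ≤ _ := by gcongr; exact hb k

/-- The state of a power stable system is controlled by its inputs. -/
theorem IsPowerStable.exists_norm_sq_le {M : Matrix (Fin n) (Fin n) ℝ} (hM : IsPowerStable M) :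
    ∃ C ρ : ℝ, 0 < C ∧ 0 ≤ ρ ∧ ρ < 1 ∧
      ∀ d w : ℕ → EuclideanSpace ℝ (Fin n),
        (∀ k, d (k + 1) = Matrix.toEuclideanLin M (d k) + w k) →
        ∀ k, ‖d k‖ ^ 2 ≤ C * scalarRec ρ (‖d 0‖ ^ 2) (fun j => ‖w j‖ ^ 2) k := by
  obtain ⟨C, ρ, hC, hρ, hρ1, hb⟩ := hM
  have h1 : 0 < 1 - ρ := by linarith
  refine ⟨C ^ 2 * (1 - ρ)⁻¹, ρ, by positivity, hρ, hρ1, fun d w hd k => ?_⟩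
  -- Bounding all `M ^ m (d k)` at once lets the induction on `k` close without an explicit
  -- convolution sum.
  have key : ∀ k m, ‖Matrix.toEuclideanLin (M ^ m) (d k)‖ ≤
      C * ρ ^ m * scalarRec ρ ‖d 0‖ (fun j => ‖w j‖) k := by
    intro k
    induction k with
    | zero => exact fun m => hb m _
    | succ k ih =>
      intro m
      rw [hd, map_add, ← toEuclideanLin_mul, ← pow_succ, scalarRec]
      calc _ ≤ _ := norm_add_le _ _
        _ ≤ C * ρ ^ (m + 1) * scalarRec ρ ‖d 0‖ (fun j => ‖w j‖) k + C * ρ ^ m * ‖w k‖ :=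
          add_le_add (ih _) (hb _ _)
        _ = _ := by ring
  have h0 := key k 0
  simp only [pow_zero, Matrix.toLpLin_one, LinearMap.id_apply, mul_one] at h0
  have h2 := scalarRec_sq_le (a := ‖d 0‖) (w := fun j => ‖w j‖) hρ hρ1 k
  calc ‖d k‖ ^ 2 ≤ (C * scalarRec ρ ‖d 0‖ (fun j => ‖w j‖) k) ^ 2 := by gcongr
    _ = C ^ 2 * scalarRec ρ ‖d 0‖ (fun j => ‖w j‖) k ^ 2 := by ring
    _ ≤ C ^ 2 * ((1 - ρ)⁻¹ * scalarRec ρ (‖d 0‖ ^ 2) (fun j => ‖w j‖ ^ 2) k) := by gcongr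
    _ = _ := by ring

/-- Datko's criterion: square summability of all orbits implies geometric decay. -/
theorem isPowerStable_of_sum_sq_le {M : Matrix (Fin n) (Fin n) ℝ} {c : ℝ}
    (h : ∀ (N : ℕ) (x : EuclideanSpace ℝ (Fin n)),
      ∑ k ∈ Finset.range N, ‖Matrix.toEuclideanLin (M ^ k) x‖ ^ 2 ≤ c * ‖x‖ ^ 2) :
    IsPowerStable M := by
  -- The maximum with `1` makes the contraction factor `1 - b⁻¹` nonnegative.
  set b := max c 1 with hb
  have hb1 : 1 ≤ b := le_max_right _ _
  have hb0 : 0 < b := by linarith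
  have hle : ∀ x : EuclideanSpace ℝ (Fin n), c * ‖x‖ ^ 2 ≤ b * ‖x‖ ^ 2 := fun x => by
    gcongr; exact le_max_left _ _
  -- The total energy of an orbit is a Lyapunov function: one step lowers it by `‖x‖²`, which is at
  -- least the fraction `b⁻¹` of it.
  let v : EuclideanSpace ℝ (Fin n) → ℝ := fun x => ∑' k, ‖Matrix.toEuclideanLin (M ^ k) x‖ ^ 2
  have hsum : ∀ x, Summable fun k => ‖Matrix.toEuclideanLin (M ^ k) x‖ ^ 2 := fun x =>
    summable_of_sum_range_le (fun _ => sq_nonneg _) fun N => h N x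
  have hv_le : ∀ x, v x ≤ b * ‖x‖ ^ 2 := fun x =>
    (Real.tsum_le_of_sum_range_le (fun _ => sq_nonneg _) fun N => h N x).trans (hle x)
  have hv_step : ∀ x, v x = ‖x‖ ^ 2 + v (Matrix.toEuclideanLin M x) := fun x => by
    simp only [v]
    rw [(hsum x).tsum_eq_zero_add]
    simp [pow_succ]
  have hv0 : ∀ x, 0 ≤ v x := fun x => tsum_nonneg fun _ => sq_nonneg _
  have hdec : ∀ x, v (Matrix.toEuclideanLin M x) ≤ (1 - b⁻¹) * v x := fun x => by
    have h1 := hv_step x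
    have h2 : b⁻¹ * v x ≤ ‖x‖ ^ 2 := by rw [inv_mul_le_iff₀ hb0]; exact hv_le x
    linarith
  have hr0 : 0 ≤ 1 - b⁻¹ := by
    have := inv_le_one_of_one_le₀ hb1
    linarith
  have hr1 : 1 - b⁻¹ < 1 := by
    have := inv_pos.mpr hb0
    linarith
  have hiter : ∀ k x, v (Matrix.toEuclideanLin (M ^ k) x) ≤ (1 - b⁻¹) ^ k * v x := by
    intro k x
    induction k with
    | zero => simp
    | succ k ih =>
      rw [toEuclideanLin_pow_succ, pow_succ', mul_assoc]
      exact (hdec _).trans (by gcongr)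
  refine ⟨√b, √(1 - b⁻¹), by positivity, by positivity, ?_, fun k x => ?_⟩
  · rw [Real.sqrt_lt' one_pos]; linarith
  · apply le_of_sq_le_sq _ (by positivity)
    calc ‖Matrix.toEuclideanLin (M ^ k) x‖ ^ 2 ≤ v (Matrix.toEuclideanLin (M ^ k) x) := by
          rw [hv_step]; linarith [hv0 (Matrix.toEuclideanLin M (Matrix.toEuclideanLin (M ^ k) x))]
      _ ≤ (1 - b⁻¹) ^ k * (b * ‖x‖ ^ 2) := (hiter k x).trans (by gcongr; exact hv_le x)
      _ = (√b * √(1 - b⁻¹) ^ k * ‖x‖) ^ 2 := by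
        rw [mul_pow, mul_pow, ← pow_mul, mul_comm k 2, pow_mul, Real.sq_sqrt hb0.le,
          Real.sq_sqrt hr0]
        ring

end PowerStability

/-! ### Riccati solutions: stability, uniqueness, definiteness, existence -/

section Riccati

variable {n l : ℕ}
variable {A : Matrix (Fin n) (Fin n) ℝ} {B : Matrix (Fin n) (Fin l) ℝ}
  {Q : Matrix (Fin n) (Fin n) ℝ} {R : Matrix (Fin l) (Fin l) ℝ} {P : Matrix (Fin n) (Fin n) ℝ}

theorem IsPowerStable.exists_sum_norm_sq_le {M : Matrix (Fin n) (Fin n) ℝ}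
    (hM : IsPowerStable M) :
    ∃ C : ℝ, 0 < C ∧ ∀ d w : ℕ → EuclideanSpace ℝ (Fin n),
      (∀ k, d (k + 1) = Matrix.toEuclideanLin M (d k) + w k) → ∀ N,
        ∑ k ∈ Finset.range N, ‖d k‖ ^ 2 ≤
          C * (‖d 0‖ ^ 2 + ∑ k ∈ Finset.range N, ‖w k‖ ^ 2) := by
  obtain ⟨C, ρ, hC, hρ, hρ1, hb⟩ := hM.exists_norm_sq_le
  have h1 : 0 < 1 - ρ := by linarith
  refine ⟨C * (1 - ρ)⁻¹, by positivity, fun d w hd N => ?_⟩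
  calc _ ≤ ∑ k ∈ Finset.range N, C * scalarRec ρ (‖d 0‖ ^ 2) (fun j => ‖w j‖ ^ 2) k :=
        Finset.sum_le_sum fun k _ => hb d w hd k
    _ ≤ C * ((1 - ρ)⁻¹ * (‖d 0‖ ^ 2 + ∑ k ∈ Finset.range N, ‖w k‖ ^ 2)) := by
        rw [← Finset.mul_sum]
        gcongr
        exact sum_scalarRec_le hρ hρ1 (sq_nonneg _) (fun _ => sq_nonneg _) N
    _ = _ := by ring

theorem IsPowerStable.exists_sum_norm_pow_sq_le {M : Matrix (Fin n) (Fin n) ℝ}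
    (hM : IsPowerStable M) :
    ∃ C : ℝ, 0 < C ∧ ∀ (x : EuclideanSpace ℝ (Fin n)) (N : ℕ),
      ∑ k ∈ Finset.range N, ‖Matrix.toEuclideanLin (M ^ k) x‖ ^ 2 ≤ C * ‖x‖ ^ 2 := by
  obtain ⟨C, hC, hb⟩ := hM.exists_sum_norm_sq_le
  refine ⟨C, hC, fun x N => ?_⟩
  have := hb (fun k => Matrix.toEuclideanLin (M ^ k) x) 0
    (fun k => by rw [toEuclideanLin_pow_succ]; simp) N
  simpa only [pow_zero, Matrix.toLpLin_one, LinearMap.id_apply, Pi.zero_apply, norm_zero,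
    ne_eq, OfNat.ofNat_ne_zero, not_false_eq_true, zero_pow, Finset.sum_const_zero,
    add_zero] using this

theorem IsPowerStable.tendsto_pow {M : Matrix (Fin n) (Fin n) ℝ} (hM : IsPowerStable M)
    (x : EuclideanSpace ℝ (Fin n)) :
    Filter.Tendsto (fun k => Matrix.toEuclideanLin (M ^ k) x) Filter.atTop (nhds 0) := by
  obtain ⟨C, hC, hb⟩ := hM.exists_sum_norm_pow_sq_le
  have hs : Summable fun k => ‖Matrix.toEuclideanLin (M ^ k) x‖ ^ 2 :=
    summable_of_sum_range_le (fun _ => sq_nonneg _) (hb x)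
  rw [tendsto_zero_iff_norm_tendsto_zero]
  have := hs.tendsto_atTop_zero.sqrt
  simpa [Real.sqrt_sq] using this

theorem SolvesRiccati.eq_riccatiMap (h : SolvesRiccati A B Q R P) :
    riccatiMap A B Q R P = P := h.symm

theorem SolvesRiccati.weightedSq_eq (hR : R.PosDef) (hP : P.PosSemidef)
    (h : SolvesRiccati A B Q R P) (x : EuclideanSpace ℝ (Fin n)) :
    weightedSq P x = weightedSq Q x +
      weightedSq R (Matrix.toEuclideanLin (gain A B R P) x) +
      weightedSq P (Matrix.toEuclideanLin (A + B * gain A B R P) x) := by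
  have := weightedSq_riccatiMap_gain (A := A) (B := B) (Q := Q) hR hP x
  rwa [h.eq_riccatiMap] at this

/-- Output injection rewrites `A x + B u` as `(A + L √Q) x` plus the vector estimated here. For a
detecting `L`, small stage costs thus act as small inputs to a stable system. -/
theorem exists_norm_input_sub_injection_sq_le (hQ : Q.PosSemidef) (hR : R.PosDef)
    (B : Matrix (Fin n) (Fin l) ℝ) (L : Matrix (Fin n) (Fin n) ℝ) :
    ∃ c : ℝ, 0 < c ∧ ∀ (x : EuclideanSpace ℝ (Fin n)) (u : EuclideanSpace ℝ (Fin l)),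
      ‖Matrix.toEuclideanLin B u - Matrix.toEuclideanLin (L * CFC.sqrt Q) x‖ ^ 2 ≤
        c * (weightedSq Q x + weightedSq R u) := by
  obtain ⟨b, hb, hB⟩ := exists_norm_toEuclideanLin_le B
  obtain ⟨m, hm, hL⟩ := exists_norm_toEuclideanLin_le L
  obtain ⟨r, hr, hRr⟩ := exists_le_weightedSq hR
  refine ⟨2 * b ^ 2 * r⁻¹ + 2 * m ^ 2, by positivity, fun x u => ?_⟩
  rw [toEuclideanLin_mul]
  set y := Matrix.toEuclideanLin (CFC.sqrt Q) x with hy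
  have hyQ : ‖y‖ ^ 2 = weightedSq Q x := norm_toEuclideanLin_sqrt_sq hQ x
  have hu : ‖u‖ ^ 2 ≤ r⁻¹ * weightedSq R u := by rw [le_inv_mul_iff₀ hr]; exact hRr u
  have hRu := weightedSq_nonneg hR.posSemidef u
  have hQx := weightedSq_nonneg hQ x
  calc ‖Matrix.toEuclideanLin B u - Matrix.toEuclideanLin L y‖ ^ 2
      ≤ (b * ‖u‖ + m * ‖y‖) ^ 2 := by
        gcongr
        exact (norm_sub_le _ _).trans (add_le_add (hB u) (hL y))
    _ ≤ 2 * b ^ 2 * ‖u‖ ^ 2 + 2 * m ^ 2 * ‖y‖ ^ 2 := by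
        nlinarith [sq_nonneg (b * ‖u‖ - m * ‖y‖)]
    _ ≤ 2 * b ^ 2 * (r⁻¹ * weightedSq R u) + 2 * m ^ 2 * weightedSq Q x := by
        rw [hyQ]; gcongr
    _ ≤ _ := by
        have h1 : 0 ≤ 2 * b ^ 2 * r⁻¹ * weightedSq Q x := by positivity
        have h2 : 0 ≤ 2 * m ^ 2 * weightedSq R u := by positivity
        linarith

/-- The closed loop of a positive semidefinite solution is stable. -/
theorem SolvesRiccati.isPowerStable (hQ : Q.PosSemidef) (hR : R.PosDef)
    (hAQ : IsDetectable A (CFC.sqrt Q)) (hP : P.PosSemidef) (h : SolvesRiccati A B Q R P) :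
    IsPowerStable (A + B * gain A B R P) := by
  obtain ⟨L, hL⟩ := hAQ
  obtain ⟨C, hC, hb⟩ := hL.isPowerStable.exists_sum_norm_sq_le
  obtain ⟨c, hc, hin⟩ := exists_norm_input_sub_injection_sq_le hQ hR B L
  obtain ⟨p, hp, hPp⟩ := exists_abs_weightedSq_le P
  set K := gain A B R P with hK
  set M := A + B * K with hM
  refine isPowerStable_of_sum_sq_le (c := C * (1 + c * p)) fun N x => ?_
  let d : ℕ → EuclideanSpace ℝ (Fin n) := fun k => Matrix.toEuclideanLin (M ^ k) x
  let w : ℕ → EuclideanSpace ℝ (Fin n) := fun k =>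
    Matrix.toEuclideanLin B (Matrix.toEuclideanLin K (d k)) -
      Matrix.toEuclideanLin (L * CFC.sqrt Q) (d k)
  have hd : ∀ k, d (k + 1) = Matrix.toEuclideanLin (A + L * CFC.sqrt Q) (d k) + w k := by
    intro k
    simp only [d, w, toEuclideanLin_pow_succ, ← toEuclideanLin_mul B K]
    simp only [hM, map_add, LinearMap.add_apply]
    abel
  -- The Riccati identity telescopes along the closed loop, so the total cost is at most `‖x‖_P²`,
  -- which bounds the energy of `w`.
  have hcost : ∀ N, ∑ k ∈ Finset.range N,
      (weightedSq Q (d k) + weightedSq R (Matrix.toEuclideanLin K (d k))) +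
        weightedSq P (d N) = weightedSq P x := by
    intro N
    induction N with
    | zero => simp [d]
    | succ N ih =>
      have h1 := h.weightedSq_eq hR hP (d N)
      have h2 : d (N + 1) = Matrix.toEuclideanLin M (d N) := toEuclideanLin_pow_succ _ _ _
      rw [← hK, ← hM] at h1
      rw [Finset.sum_range_succ, h2]
      linarith
  have hw : ∑ k ∈ Finset.range N, ‖w k‖ ^ 2 ≤ c * (p * ‖x‖ ^ 2) :=
    calc _ ≤ ∑ k ∈ Finset.range N,
          c * (weightedSq Q (d k) + weightedSq R (Matrix.toEuclideanLin K (d k))) :=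
          Finset.sum_le_sum fun k _ => hin _ _
      _ ≤ c * (p * ‖x‖ ^ 2) := by
          rw [← Finset.mul_sum]
          gcongr
          linarith [hcost N, weightedSq_nonneg hP (d N), le_abs_self (weightedSq P x), hPp x]
  have hd0 : d 0 = x := by simp [d]
  calc _ ≤ C * (‖d 0‖ ^ 2 + ∑ k ∈ Finset.range N, ‖w k‖ ^ 2) := hb d w hd N
    _ ≤ C * (‖x‖ ^ 2 + c * (p * ‖x‖ ^ 2)) := by rw [hd0]; gcongr
    _ = _ := by ring

/-- The feedback of `P'` is optimal for `P'` but possibly not for `P`, so the difference of the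
forms of `P` and `P'` cannot decrease along its closed loop. Those orbits tend to `0`, so the
difference is nonpositive at the start. -/
theorem SolvesRiccati.weightedSq_le {P' : Matrix (Fin n) (Fin n) ℝ} (hQ : Q.PosSemidef)
    (hR : R.PosDef) (hAQ : IsDetectable A (CFC.sqrt Q))
    (hP : P.PosSemidef) (h : SolvesRiccati A B Q R P)
    (hP' : P'.PosSemidef) (h' : SolvesRiccati A B Q R P') (x : EuclideanSpace ℝ (Fin n)) :
    weightedSq P x ≤ weightedSq P' x := by
  have hstab := h'.isPowerStable hQ hR hAQ hP'
  have hstep : ∀ y, weightedSq P y - weightedSq P' y ≤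
      weightedSq P (Matrix.toEuclideanLin (A + B * gain A B R P') y) -
        weightedSq P' (Matrix.toEuclideanLin (A + B * gain A B R P') y) := by
    intro y
    have h1 := h'.weightedSq_eq hR hP' y
    have h2 := weightedSq_riccatiMap_le (A := A) (B := B) (Q := Q) hR hP y
      (Matrix.toEuclideanLin (gain A B R P') y)
    rw [h.eq_riccatiMap, ← toEuclideanLin_mul, ← LinearMap.add_apply, ← map_add] at h2
    linarith
  have hiter : ∀ N : ℕ, weightedSq P x - weightedSq P' x ≤
      weightedSq P (Matrix.toEuclideanLin ((A + B * gain A B R P') ^ N) x) -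
        weightedSq P' (Matrix.toEuclideanLin ((A + B * gain A B R P') ^ N) x) := by
    intro N
    induction N with
    | zero => simp
    | succ N ih => rw [toEuclideanLin_pow_succ]; exact ih.trans (hstep _)
  have hlim := ((continuous_weightedSq P).tendsto 0).comp (hstab.tendsto_pow x)
  have hlim' := ((continuous_weightedSq P').tendsto 0).comp (hstab.tendsto_pow x)
  have := ge_of_tendsto' (hlim.sub hlim') hiter
  simp only [weightedSq, inner_zero_left, sub_zero] at this ⊢
  linarith

theorem SolvesRiccati.unique {P' : Matrix (Fin n) (Fin n) ℝ} (hQ : Q.PosSemidef)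
    (hR : R.PosDef) (hAQ : IsDetectable A (CFC.sqrt Q))
    (hP : P.PosSemidef) (h : SolvesRiccati A B Q R P)
    (hP' : P'.PosSemidef) (h' : SolvesRiccati A B Q R P') : P = P' :=
  eq_of_weightedSq_eq hP.isHermitian hP'.isHermitian fun x =>
    le_antisymm (h.weightedSq_le hQ hR hAQ hP hP' h' x) (h'.weightedSq_le hQ hR hAQ hP' hP h x)

theorem SolvesRiccati.posDef (hQ : Q.PosSemidef) (hR : R.PosDef) (hP : P.PosSemidef)
    (h : SolvesRiccati A B Q R P) (hobs : IsObservable A (CFC.sqrt Q)) : P.PosDef := by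
  have key : ∀ x, weightedSq P x = 0 → x = 0 := by
    intro x hx
    -- All terms of the Riccati identity vanish at a zero of the form of `P`. Hence the feedback is
    -- zero there, the zero set is invariant under `A` itself, and the whole output sequence is
    -- zero.
    have hzero : ∀ y, weightedSq P y = 0 → Matrix.toEuclideanLin (CFC.sqrt Q) y = 0 ∧
        weightedSq P (Matrix.toEuclideanLin A y) = 0 := by
      intro y hy
      have h1 := h.weightedSq_eq hR hP y
      have h2 := weightedSq_nonneg hQ y
      have h3 := weightedSq_nonneg hR.posSemidef (Matrix.toEuclideanLin (gain A B R P) y)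
      have h4 := weightedSq_nonneg hP (Matrix.toEuclideanLin (A + B * gain A B R P) y)
      have hK : Matrix.toEuclideanLin (gain A B R P) y = 0 := by
        by_contra hne
        have := weightedSq_pos hR hne
        linarith
      refine ⟨?_, ?_⟩
      · rw [← norm_eq_zero, ← sq_eq_zero_iff, norm_toEuclideanLin_sqrt_sq hQ]
        linarith
      · rw [map_add, LinearMap.add_apply, toEuclideanLin_mul B, hK, map_zero, add_zero] at h1 h4
        rw [hK] at h3
        linarith
    have hall : ∀ k, weightedSq P (Matrix.toEuclideanLin (A ^ k) x) = 0 := by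
      intro k
      induction k with
      | zero => simpa using hx
      | succ k ih => rw [toEuclideanLin_pow_succ]; exact (hzero _ ih).2
    have hx0 := hobs x.ofLp fun k => by
      have := (hzero _ (hall k)).1
      rw [← toEuclideanLin_mul] at this
      exact congrArg WithLp.ofLp this
    ext i
    simp [hx0]
  refine Matrix.PosDef.of_dotProduct_mulVec_pos hP.isHermitian fun x hx => ?_
  have hne : weightedSq P (WithLp.toLp 2 x) ≠ 0 := fun h0 => hx <| by
    simpa using congrArg WithLp.ofLp (key _ h0)
  have := lt_of_le_of_ne (weightedSq_nonneg hP _) hne.symm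
  simpa [weightedSq_eq_dotProduct] using this

theorem weightedSq_riccatiMap_mono {P' : Matrix (Fin n) (Fin n) ℝ} (hR : R.PosDef)
    (hP : P.PosSemidef) (hP' : P'.PosSemidef) (hle : ∀ x, weightedSq P x ≤ weightedSq P' x)
    (x : EuclideanSpace ℝ (Fin n)) :
    weightedSq (riccatiMap A B Q R P) x ≤ weightedSq (riccatiMap A B Q R P') x := by
  have h1 := weightedSq_riccatiMap_le (A := A) (B := B) (Q := Q) hR hP x
    (Matrix.toEuclideanLin (gain A B R P') x)
  rw [← toEuclideanLin_mul, ← LinearMap.add_apply, ← map_add] at h1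
  rw [weightedSq_riccatiMap_gain hR hP']
  linarith [hle (Matrix.toEuclideanLin (A + B * gain A B R P') x)]

theorem continuousAt_riccatiMap (hR : R.PosDef) (hP : P.PosSemidef) :
    ContinuousAt (riccatiMap A B Q R) P := by
  have hdet : (R + Bᵀ * P * B).det ≠ 0 := (posDef_add_transpose_mul_mul hR hP).det_pos.ne'
  have hinv : ContinuousAt (fun X : Matrix (Fin n) (Fin n) ℝ => (R + Bᵀ * X * B)⁻¹) P := by
    have hlin : Continuous fun X : Matrix (Fin n) (Fin n) ℝ => R + Bᵀ * X * B := by fun_prop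
    simp only [Matrix.inv_def, Ring.inverse_eq_inv']
    exact (hlin.matrix_det.continuousAt.inv₀ hdet).smul hlin.matrix_adjugate.continuousAt
  unfold riccatiMap
  fun_prop

/-- By polarization every matrix entry is a fixed combination of three values of the form. -/
theorem exists_tendsto_of_weightedSq_tendsto {p : ℕ → Matrix (Fin n) (Fin n) ℝ}
    (hp : ∀ k, (p k).IsHermitian) {q : EuclideanSpace ℝ (Fin n) → ℝ}
    (h : ∀ x, Filter.Tendsto (fun k => weightedSq (p k) x) Filter.atTop (nhds (q x))) :
    ∃ P : Matrix (Fin n) (Fin n) ℝ, Filter.Tendsto p Filter.atTop (nhds P) := by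
  let e : Fin n → EuclideanSpace ℝ (Fin n) := fun i => EuclideanSpace.single i 1
  have hentry : ∀ k i j, p k i j =
      (weightedSq (p k) (e j + e i) - weightedSq (p k) (e j) - weightedSq (p k) (e i)) / 2 := by
    intro k i j
    have h1 : inner ℝ (Matrix.toEuclideanLin (p k) (e j)) (e i) = p k i j := by
      simp [e, PiLp.inner_apply]
    rw [weightedSq_add (hp k), h1]
    ring
  refine ⟨fun i j => (q (e j + e i) - q (e j) - q (e i)) / 2, ?_⟩
  refine tendsto_pi_nhds.mpr fun i => tendsto_pi_nhds.mpr fun j => ?_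
  simp_rw [hentry]
  exact (((h _).sub (h _)).sub (h _)).div_const 2

theorem exists_solvesRiccati (hAB : IsStabilizable A B) (hQ : Q.PosSemidef) (hR : R.PosDef) :
    ∃ P : Matrix (Fin n) (Fin n) ℝ, P.PosSemidef ∧ SolvesRiccati A B Q R P := by
  obtain ⟨F, hF⟩ := hAB
  obtain ⟨C, hC, hb⟩ := hF.isPowerStable.exists_sum_norm_pow_sq_le
  obtain ⟨a, ha, hQa⟩ := exists_abs_weightedSq_le Q
  obtain ⟨b, hb0, hRb⟩ := exists_abs_weightedSq_le R
  obtain ⟨f, hf, hFf⟩ := exists_norm_toEuclideanLin_le F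
  -- Value iteration: the form of `p k` is the optimal deterministic cost over `k` steps with no
  -- terminal cost.
  let p : ℕ → Matrix (Fin n) (Fin n) ℝ := fun k => (riccatiMap A B Q R)^[k] 0
  have hp_succ : ∀ k, p (k + 1) = riccatiMap A B Q R (p k) := fun k =>
    Function.iterate_succ_apply' _ _ _
  have hp : ∀ k, (p k).PosSemidef := by
    intro k
    induction k with
    | zero => exact Matrix.PosSemidef.zero
    | succ k ih => rw [hp_succ]; exact posSemidef_riccatiMap hQ hR ih
  have hmono : ∀ k x, weightedSq (p k) x ≤ weightedSq (p (k + 1)) x := by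
    intro k
    induction k with
    | zero =>
      intro x
      have h0 : weightedSq (p 0) x = 0 := weightedSq_zero_left x
      rw [h0]
      exact weightedSq_nonneg (hp 1) x
    | succ k ih =>
      intro x
      rw [hp_succ, hp_succ (k + 1)]
      exact weightedSq_riccatiMap_mono hR (hp k) (hp (k + 1)) ih x
  have hcost : ∀ y, weightedSq Q y + weightedSq R (Matrix.toEuclideanLin F y) ≤
      (a + b * f ^ 2) * ‖y‖ ^ 2 := by
    intro y
    have h1 := (le_abs_self _).trans (hQa y)
    have h2 := (le_abs_self _).trans (hRb (Matrix.toEuclideanLin F y))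
    have h3 : ‖Matrix.toEuclideanLin F y‖ ^ 2 ≤ (f * ‖y‖) ^ 2 := by gcongr; exact hFf y
    nlinarith
  -- The stabilizing feedback `F` is a competitor over each horizon, and its cost is bounded
  -- uniformly in `k`.
  have hbound : ∀ k x, weightedSq (p k) x ≤ (a + b * f ^ 2) *
      ∑ j ∈ Finset.range k, ‖Matrix.toEuclideanLin ((A + B * F) ^ j) x‖ ^ 2 := by
    intro k
    induction k with
    | zero =>
      intro x
      have h0 : weightedSq (p 0) x = 0 := weightedSq_zero_left x
      simp [h0]
    | succ k ih =>
      intro x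
      have h1 := weightedSq_riccatiMap_le (A := A) (B := B) (Q := Q) hR (hp k) x
        (Matrix.toEuclideanLin F x)
      rw [← hp_succ, ← toEuclideanLin_mul, ← LinearMap.add_apply, ← map_add] at h1
      have h2 := ih (Matrix.toEuclideanLin (A + B * F) x)
      have h3 := hcost x
      rw [Finset.sum_range_succ', mul_add]
      simp only [← toEuclideanLin_mul, ← pow_succ] at h2
      simp only [pow_zero, Matrix.toLpLin_one, LinearMap.id_apply]
      linarith
  have hconv : ∀ x, Filter.Tendsto (fun k => weightedSq (p k) x) Filter.atTop
      (nhds (⨆ k, weightedSq (p k) x)) := fun x =>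
    tendsto_atTop_ciSup (monotone_nat_of_le_succ fun k => hmono k x)
      ⟨(a + b * f ^ 2) * (C * ‖x‖ ^ 2), by
        rintro _ ⟨k, rfl⟩
        exact (hbound k x).trans (by gcongr; exact hb x k)⟩
  obtain ⟨P, hP⟩ := exists_tendsto_of_weightedSq_tendsto (fun k => (hp k).isHermitian) hconv
  have hPsd : P.PosSemidef := by
    refine posSemidef_of_weightedSq_nonneg ?_ fun x => ?_
    · refine tendsto_nhds_unique ?_ hP
      have : Filter.Tendsto (fun k => (p k)ᴴ) Filter.atTop (nhds Pᴴ) :=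
        (continuous_id.matrix_conjTranspose.tendsto P).comp hP
      exact this.congr fun k => (hp k).isHermitian
    · have hcont : Continuous fun M : Matrix (Fin n) (Fin n) ℝ => weightedSq M x := by
        simp only [weightedSq_eq_dotProduct]
        fun_prop
      exact ge_of_tendsto' ((hcont.tendsto P).comp hP) fun k => weightedSq_nonneg (hp k) x
  refine ⟨P, hPsd, ?_⟩
  have h1 : Filter.Tendsto (fun k => riccatiMap A B Q R (p k)) Filter.atTop
      (nhds (riccatiMap A B Q R P)) := (continuousAt_riccatiMap hR hPsd).tendsto.comp hP
  have h2 := (Filter.tendsto_add_atTop_iff_nat 1).mpr hP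
  simp only [hp_succ] at h2
  exact tendsto_nhds_unique h2 h1

end Riccati

/-! ### Independence of the present noise from the past -/

section Independence

variable {Ω : Type*} {mΩ : MeasurableSpace Ω} {Pr : Measure Ω} {n l : ℕ}

/-- Associativity of product measures. It allows the initial state to be adjoined to the past noise.
-/
theorem indepFun_prodMk_of_indepFun_prodMk [IsProbabilityMeasure Pr] {α β γ : Type*}
    [MeasurableSpace α] [MeasurableSpace β] [MeasurableSpace γ] {X : Ω → α} {Y : Ω → β}
    {Z : Ω → γ} (hX : Measurable X) (hY : Measurable Y) (hZ : Measurable Z)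
    (hXYZ : IndepFun X (fun ω => (Y ω, Z ω)) Pr) (hYZ : IndepFun Y Z Pr) :
    IndepFun (fun ω => (X ω, Y ω)) Z Pr := by
  have hXY : IndepFun X Y Pr := hXYZ.comp measurable_id measurable_fst
  have : IsProbabilityMeasure (Pr.map X) := Measure.isProbabilityMeasure_map hX.aemeasurable
  have : IsProbabilityMeasure (Pr.map Y) := Measure.isProbabilityMeasure_map hY.aemeasurable
  have : IsProbabilityMeasure (Pr.map Z) := Measure.isProbabilityMeasure_map hZ.aemeasurable
  rw [indepFun_iff_map_prod_eq_prod_map_map (by fun_prop) (by fun_prop)] at hXYZ hYZ hXY ⊢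
  rw [hXY]
  apply MeasurableEquiv.prodAssoc.map_measurableEquiv_injective
  rw [Measure.prodAssoc_prod, ← hYZ, ← hXYZ, Measure.map_map (by fun_prop) (by fun_prop)]
  rfl

/-- The initial state together with the disturbances before time `k`. -/
def noisePast (W : ℕ → Ω → EuclideanSpace ℝ (Fin n)) (X₀ : Ω → EuclideanSpace ℝ (Fin n)) (k : ℕ)
    (ω : Ω) : EuclideanSpace ℝ (Fin n) × (Finset.range k → EuclideanSpace ℝ (Fin n)) :=
  (X₀ ω, fun j => W j ω)

/-- The σ-algebra generated by the initial state and the disturbances before time `k`. -/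
abbrev noiseHistory (W : ℕ → Ω → EuclideanSpace ℝ (Fin n)) (X₀ : Ω → EuclideanSpace ℝ (Fin n))
    (k : ℕ) : MeasurableSpace Ω :=
  MeasurableSpace.comap (noisePast W X₀ k) inferInstance

variable {W : ℕ → Ω → EuclideanSpace ℝ (Fin n)} {X₀ : Ω → EuclideanSpace ℝ (Fin n)}

theorem measurable_noisePast_initial (k : ℕ) : Measurable[noiseHistory W X₀ k] X₀ :=
  measurable_fst.comp (comap_measurable (noisePast W X₀ k))

theorem measurable_noisePast_noise {j k : ℕ} (hjk : j < k) :
    Measurable[noiseHistory W X₀ k] (W j) := by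
  have h1 : Measurable fun p : EuclideanSpace ℝ (Fin n) ×
      (Finset.range k → EuclideanSpace ℝ (Fin n)) => p.2 ⟨j, Finset.mem_range.mpr hjk⟩ := by
    fun_prop
  exact h1.comp (comap_measurable (noisePast W X₀ k))

theorem noiseHistory_mono {j k : ℕ} (hjk : j ≤ k) : noiseHistory W X₀ j ≤ noiseHistory W X₀ k := by
  apply Measurable.comap_le
  exact (measurable_noisePast_initial k).prodMk <|
    @measurable_pi_lambda _ _ _ (noiseHistory W X₀ k) _ _ fun i =>
      measurable_noisePast_noise ((Finset.mem_range.mp i.2).trans_le hjk)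

theorem indepFun_noisePast [IsProbabilityMeasure Pr] (hW : ∀ k, Measurable (W k))
    (hWindep : iIndepFun W Pr) (hX₀ : Measurable X₀)
    (hX₀W : IndepFun X₀ (fun ω k => W k ω) Pr) (k : ℕ) :
    IndepFun (noisePast W X₀ k) (W k) Pr := by
  have h1 : IndepFun (fun ω (j : Finset.range k) => W j ω) (W k) Pr := by
    have := hWindep.indepFun_finset (Finset.range k) {k} (by simp) hW
    exact this.comp measurable_id
      (measurable_pi_apply (⟨k, Finset.mem_singleton_self k⟩ : ({k} : Finset ℕ)))
  refine indepFun_prodMk_of_indepFun_prodMk hX₀ (measurable_pi_lambda _ fun i => hW i) (hW k) ?_ h1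
  have h2 : Measurable fun w : ℕ → EuclideanSpace ℝ (Fin n) =>
      ((fun j : Finset.range k => w j), w k) := by fun_prop
  exact hX₀W.comp measurable_id h2

theorem indepFun_of_aestronglyMeasurable_noiseHistory [IsProbabilityMeasure Pr] {m : ℕ}
    (hW : ∀ k, Measurable (W k))
    (hWindep : iIndepFun W Pr) (hX₀ : Measurable X₀)
    (hX₀W : IndepFun X₀ (fun ω k => W k ω) Pr) {k : ℕ} {Y : Ω → EuclideanSpace ℝ (Fin m)}
    (hY : AEStronglyMeasurable[noiseHistory W X₀ k] Y Pr) : IndepFun Y (W k) Pr := by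
  obtain ⟨y, hy, hYy⟩ := hY
  have h := indepFun_noisePast hW hWindep hX₀ hX₀W k
  obtain ⟨g, hg, rfl⟩ := hy.measurable.exists_eq_measurable_comp
  exact (h.comp hg measurable_id).congr hYy.symm (Filter.EventuallyEq.refl _ _)

/-- A history-measurable function factors through the states up to time `k`, and these can be
replaced by `G`-measurable versions off a null set. -/
theorem aestronglyMeasurable_of_history {G : MeasurableSpace Ω} {m : ℕ}
    {X : ℕ → Ω → EuclideanSpace ℝ (Fin n)} {k : ℕ}
    (hX : ∀ j ≤ k, AEStronglyMeasurable[G] (X j) Pr) {f : Ω → EuclideanSpace ℝ (Fin m)}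
    (hf : AEStronglyMeasurable[history X k] f Pr) : AEStronglyMeasurable[G] f Pr := by
  obtain ⟨g, hg, hfg⟩ := hf
  obtain ⟨h, hh, rfl⟩ := hg.measurable.exists_eq_measurable_comp
  choose! x hx hXx using hX
  have hm : Measurable[G] fun ω (j : Set.Iic k) => x j ω :=
    measurable_pi_lambda _ fun j => (hx j j.2).measurable
  refine ⟨fun ω => h fun j : Set.Iic k => x j ω, (hh.comp hm).stronglyMeasurable, ?_⟩
  have hall : ∀ᵐ ω ∂Pr, ∀ j : Set.Iic k, X j ω = x j ω :=
    ae_all_iff.mpr fun j => hXx j j.2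
  filter_upwards [hfg, hall] with ω h1 h2
  rw [h1, Function.comp_apply]
  congr 1
  funext j
  exact h2 j

variable {A : Matrix (Fin n) (Fin n) ℝ} {B : Matrix (Fin n) (Fin l) ℝ}
  {U : ℕ → Ω → EuclideanSpace ℝ (Fin l)}

theorem measurable_toEuclideanLin {p q : ℕ} (M : Matrix (Fin p) (Fin q) ℝ) :
    Measurable (Matrix.toEuclideanLin M) :=
  (LinearMap.continuous_of_finiteDimensional (Matrix.toEuclideanLin M)).measurable

theorem aestronglyMeasurable_state_of_history
    (hU : ∀ k, AEStronglyMeasurable[history (state A B W X₀ U) k] (U k) Pr) (k : ℕ) :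
    AEStronglyMeasurable[noiseHistory W X₀ k] (state A B W X₀ U k) Pr := by
  -- The control at time `k` may depend on all earlier states, so measurability of each of them with
  -- respect to the noise is needed at once.
  induction k using Nat.strong_induction_on with
  | _ k ih =>
    cases k with
    | zero => exact (measurable_noisePast_initial 0).stronglyMeasurable.aestronglyMeasurable
    | succ k =>
      have hX : ∀ j ≤ k, AEStronglyMeasurable[noiseHistory W X₀ (k + 1)] (state A B W X₀ U j) Pr :=
        fun j hj => (ih j (by omega)).mono (noiseHistory_mono (by omega))
      have hUk := aestronglyMeasurable_of_history hX (hU k)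
      have hA := (LinearMap.continuous_of_finiteDimensional
        (Matrix.toEuclideanLin A)).comp_aestronglyMeasurable (hX k le_rfl)
      have hB := (LinearMap.continuous_of_finiteDimensional
        (Matrix.toEuclideanLin B)).comp_aestronglyMeasurable hUk
      have hWk : AEStronglyMeasurable[noiseHistory W X₀ (k + 1)] (W k) Pr :=
        (measurable_noisePast_noise (Nat.lt_succ_self k)).stronglyMeasurable.aestronglyMeasurable
      exact (hA.add hB).add hWk

theorem aestronglyMeasurable_control_of_history
    (hU : ∀ k, AEStronglyMeasurable[history (state A B W X₀ U) k] (U k) Pr) (k : ℕ) :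
    AEStronglyMeasurable[noiseHistory W X₀ k] (U k) Pr :=
  aestronglyMeasurable_of_history
    (fun _ hj => (aestronglyMeasurable_state_of_history hU _).mono (noiseHistory_mono hj)) (hU k)

end Independence

/-! ### Second moments and the noise model -/

section SecondMoments

variable {Ω : Type*} {mΩ : MeasurableSpace Ω} {Pr : Measure Ω} {n l m : ℕ}

theorem memLp_toEuclideanLin {X : Ω → EuclideanSpace ℝ (Fin n)} (M : Matrix (Fin m) (Fin n) ℝ)
    (hX : MemLp X 2 Pr) : MemLp (fun ω => Matrix.toEuclideanLin M (X ω)) 2 Pr :=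
  (LinearMap.toContinuousLinearMap (Matrix.toEuclideanLin M)).comp_memLp' hX

theorem integrable_norm_sq {X : Ω → EuclideanSpace ℝ (Fin n)} (hX : MemLp X 2 Pr) :
    Integrable (fun ω => ‖X ω‖ ^ 2) Pr :=
  (memLp_two_iff_integrable_sq_norm hX.1).mp hX

theorem integrable_weightedSq {X : Ω → EuclideanSpace ℝ (Fin n)} (M : Matrix (Fin n) (Fin n) ℝ)
    (hX : MemLp X 2 Pr) : Integrable (fun ω => weightedSq M (X ω)) Pr := by
  obtain ⟨c, hc, hM⟩ := exists_abs_weightedSq_le M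
  refine ((integrable_norm_sq hX).const_mul c).mono'
    ((continuous_weightedSq M).comp_aestronglyMeasurable hX.1) (Filter.Eventually.of_forall ?_)
  exact fun ω => hM (X ω)

theorem integral_weightedSq_le {M : Matrix (Fin n) (Fin n) ℝ} {c : ℝ}
    (hM : ∀ x, |weightedSq M x| ≤ c * ‖x‖ ^ 2) {X : Ω → EuclideanSpace ℝ (Fin n)}
    (hX : MemLp X 2 Pr) : ∫ ω, weightedSq M (X ω) ∂Pr ≤ c * ∫ ω, ‖X ω‖ ^ 2 ∂Pr := by
  rw [← integral_const_mul]
  exact integral_mono (integrable_weightedSq M hX) ((integrable_norm_sq hX).const_mul c)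
    fun ω => (le_abs_self _).trans (hM (X ω))

theorem integral_weightedSq_add_of_indepFun [IsProbabilityMeasure Pr]
    {M : Matrix (Fin n) (Fin n) ℝ}
    (hM : M.IsHermitian) {Y Z : Ω → EuclideanSpace ℝ (Fin n)} (hY : MemLp Y 2 Pr)
    (hZ : MemLp Z 2 Pr) (hYZ : IndepFun Y Z Pr) (hZ0 : ∫ ω, Z ω ∂Pr = 0) :
    ∫ ω, weightedSq M (Y ω + Z ω) ∂Pr =
      ∫ ω, weightedSq M (Y ω) ∂Pr + ∫ ω, weightedSq M (Z ω) ∂Pr := by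
  have hMY := memLp_toEuclideanLin M hY
  have hind : IndepFun (fun ω => Matrix.toEuclideanLin M (Y ω)) Z Pr :=
    hYZ.comp (measurable_toEuclideanLin M) measurable_id
  have hcross : ∫ ω, inner ℝ (Matrix.toEuclideanLin M (Y ω)) (Z ω) ∂Pr = 0 := by
    have := hind.integral_bilin (hMY.integrable (by norm_num)) (hZ.integrable (by norm_num))
      (innerSL ℝ)
    rw [hZ0, map_zero] at this
    exact this
  -- The cross term is a combination of integrable quadratic terms, by polarization.
  have hint : Integrable (fun ω => inner ℝ (Matrix.toEuclideanLin M (Y ω)) (Z ω)) Pr := by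
    have h1 := integrable_weightedSq M (hY.add hZ)
    have h2 := (h1.sub (integrable_weightedSq M hY)).sub (integrable_weightedSq M hZ)
    refine (h2.div_const 2).congr (Filter.Eventually.of_forall fun ω => ?_)
    simp only [Pi.sub_apply, Pi.add_apply, weightedSq_add hM]
    ring
  simp only [weightedSq_add hM]
  rw [integral_add (f := fun ω => weightedSq M (Y ω) +
      2 * inner ℝ (Matrix.toEuclideanLin M (Y ω)) (Z ω))
    ((integrable_weightedSq M hY).add (hint.const_mul 2)) (integrable_weightedSq M hZ), integral_add (integrable_weightedSq M hY) (hint.const_mul 2),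
    integral_const_mul, hcross]
  ring

theorem integrable_and_integral_scalarRec {ρ : ℝ} {a : Ω → ℝ} {w : ℕ → Ω → ℝ}
    (ha : Integrable a Pr) (hw : ∀ k, Integrable (w k) Pr) (k : ℕ) :
    Integrable (fun ω => scalarRec ρ (a ω) (fun j => w j ω) k) Pr ∧
      ∫ ω, scalarRec ρ (a ω) (fun j => w j ω) k ∂Pr =
        scalarRec ρ (∫ ω, a ω ∂Pr) (fun j => ∫ ω, w j ω ∂Pr) k := by
  induction k with
  | zero => exact ⟨ha, rfl⟩
  | succ k ih =>
    simp only [scalarRec]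
    refine ⟨(ih.1.const_mul ρ).add (hw k), ?_⟩
    rw [integral_add (ih.1.const_mul ρ) (hw k), integral_const_mul, ih.2]

/-- Mean-square version of the input-to-state estimate for power stable systems. -/
theorem IsPowerStable.exists_integral_norm_sq_le {M : Matrix (Fin n) (Fin n) ℝ}
    (hM : IsPowerStable M) (Pr : Measure Ω) :
    ∃ C ρ : ℝ, 0 < C ∧ 0 ≤ ρ ∧ ρ < 1 ∧
      ∀ d w : ℕ → Ω → EuclideanSpace ℝ (Fin n), MemLp (d 0) 2 Pr → (∀ k, MemLp (w k) 2 Pr) →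
        (∀ k ω, d (k + 1) ω = Matrix.toEuclideanLin M (d k ω) + w k ω) →
        ∀ k, ∫ ω, ‖d k ω‖ ^ 2 ∂Pr ≤
          C * scalarRec ρ (∫ ω, ‖d 0 ω‖ ^ 2 ∂Pr) (fun j => ∫ ω, ‖w j ω‖ ^ 2 ∂Pr) k := by
  obtain ⟨C, ρ, hC, hρ, hρ1, hb⟩ := hM.exists_norm_sq_le
  refine ⟨C, ρ, hC, hρ, hρ1, fun d w hd hw hrec k => ?_⟩
  obtain ⟨h1, h2⟩ := integrable_and_integral_scalarRec (ρ := ρ) (integrable_norm_sq hd)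
    (fun j => integrable_norm_sq (hw j)) k
  rw [← h2, ← integral_const_mul]
  exact integral_mono_of_nonneg (Filter.Eventually.of_forall fun ω => sq_nonneg _)
    (h1.const_mul C) (Filter.Eventually.of_forall fun ω =>
      hb (fun k => d k ω) (fun k => w k ω) (fun k => hrec k ω) k)

end SecondMoments

/-- Square integrable data with centred disturbances that are independent of each other and of the
initial state and have uniformly bounded second moments. -/
structure IsNoiseModel {Ω : Type*} [MeasurableSpace Ω] {n : ℕ} (Pr : Measure Ω)
    (W : ℕ → Ω → EuclideanSpace ℝ (Fin n)) (X₀ : Ω → EuclideanSpace ℝ (Fin n)) : Prop where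
  measurable_noise : ∀ k, Measurable (W k)
  measurable_initial : Measurable X₀
  iIndepFun_noise : iIndepFun W Pr
  indepFun_initial : IndepFun X₀ (fun ω k => W k ω) Pr
  memLp_noise : ∀ k, MemLp (W k) 2 Pr
  memLp_initial : MemLp X₀ 2 Pr
  integral_noise : ∀ k, ∫ ω, W k ω ∂Pr = 0
  bounded_noise : ∃ β : ℝ, ∀ k, ∫ ω, ‖W k ω‖ ^ 2 ∂Pr ≤ β

/-- Gaussianity enters only here, through finite second moments, centring of the noise and its
common law. -/
theorem isNoiseModel_of_gaussian {Ω : Type*} [MeasurableSpace Ω] {n : ℕ} {Pr : Measure Ω}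
    {W : ℕ → Ω → EuclideanSpace ℝ (Fin n)} {X₀ : Ω → EuclideanSpace ℝ (Fin n)}
    {covW cov₀ : Matrix (Fin n) (Fin n) ℝ} {μ₀ : EuclideanSpace ℝ (Fin n)}
    (hW : ∀ k, Measurable (W k)) (hWlaw : ∀ k, HasLaw (W k) (multivariateGaussian 0 covW) Pr)
    (hWindep : iIndepFun W Pr) (hX₀ : Measurable X₀)
    (hX₀law : HasLaw X₀ (multivariateGaussian μ₀ cov₀) Pr)
    (hX₀W : IndepFun X₀ (fun ω k => W k ω) Pr) : IsNoiseModel Pr W X₀ where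
  measurable_noise := hW
  measurable_initial := hX₀
  iIndepFun_noise := hWindep
  indepFun_initial := hX₀W
  memLp_noise k := (IsGaussian.memLp_id _ 2 (by norm_num)).comp_measurePreserving
    ((hWlaw k).measurePreserving (hW k))
  memLp_initial := (IsGaussian.memLp_id _ 2 (by norm_num)).comp_measurePreserving
    (hX₀law.measurePreserving hX₀)
  integral_noise k := by rw [(hWlaw k).integral_eq, integral_id_multivariateGaussian]
  bounded_noise := ⟨∫ x, ‖x‖ ^ 2 ∂(multivariateGaussian 0 covW), fun k =>
    ((hWlaw k).integral_comp (f := fun x => ‖x‖ ^ 2) (by fun_prop)).le⟩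

/-! ### The closed-loop process -/

section ClosedLoop

variable {Ω : Type*} {n l : ℕ}

/-- The closed-loop state process under the feedback `u = K x`. -/
noncomputable def closedLoop (A : Matrix (Fin n) (Fin n) ℝ) (B : Matrix (Fin n) (Fin l) ℝ)
    (K : Matrix (Fin l) (Fin n) ℝ)
    (W : ℕ → Ω → EuclideanSpace ℝ (Fin n)) (X₀ : Ω → EuclideanSpace ℝ (Fin n)) :
    ℕ → Ω → EuclideanSpace ℝ (Fin n)
  | 0, ω => X₀ ω
  | k + 1, ω => Matrix.toEuclideanLin (A + B * K) (closedLoop A B K W X₀ k ω) + W k ω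

/-- The control given by the feedback law `u = K x`. -/
noncomputable def feedback (A : Matrix (Fin n) (Fin n) ℝ) (B : Matrix (Fin n) (Fin l) ℝ)
    (K : Matrix (Fin l) (Fin n) ℝ)
    (W : ℕ → Ω → EuclideanSpace ℝ (Fin n)) (X₀ : Ω → EuclideanSpace ℝ (Fin n))
    (k : ℕ) (ω : Ω) : EuclideanSpace ℝ (Fin l) :=
  Matrix.toEuclideanLin K (closedLoop A B K W X₀ k ω)

variable (A : Matrix (Fin n) (Fin n) ℝ) (B : Matrix (Fin n) (Fin l) ℝ)
  (K : Matrix (Fin l) (Fin n) ℝ)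
  (W : ℕ → Ω → EuclideanSpace ℝ (Fin n)) (X₀ : Ω → EuclideanSpace ℝ (Fin n))

/-- The feedback law refers to a state that itself depends on the control. Building the closed loop
by its own recursion and identifying it with `state` afterwards removes the circularity. -/
theorem state_feedback : state A B W X₀ (feedback A B K W X₀) = closedLoop A B K W X₀ := by
  funext k ω
  induction k with
  | zero => rfl
  | succ k ih =>
    rw [state, closedLoop, ih, feedback, map_add, LinearMap.add_apply, toEuclideanLin_mul]

theorem feedback_eq (k : ℕ) (ω : Ω) : feedback A B K W X₀ k ω =
    Matrix.toEuclideanLin K (state A B W X₀ (feedback A B K W X₀) k ω) := by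
  rw [state_feedback, feedback]

/-- The state process in terms of the deviation of the control from the feedback law. -/
theorem state_succ_sub_closedLoop_succ (U : ℕ → Ω → EuclideanSpace ℝ (Fin l)) (k : ℕ) (ω : Ω) :
    state A B W X₀ U (k + 1) ω - closedLoop A B K W X₀ (k + 1) ω =
      Matrix.toEuclideanLin (A + B * K) (state A B W X₀ U k ω - closedLoop A B K W X₀ k ω) +
        Matrix.toEuclideanLin B (U k ω - Matrix.toEuclideanLin K (state A B W X₀ U k ω)) := by
  simp only [state, closedLoop, map_sub, map_add, LinearMap.add_apply, toEuclideanLin_mul B K]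
  abel

end ClosedLoop

/-! ### Cost decomposition and comparison of controls -/

section Cost

variable {Ω : Type*} [MeasurableSpace Ω] {Pr : Measure Ω} {n l : ℕ}
  {A : Matrix (Fin n) (Fin n) ℝ} {B : Matrix (Fin n) (Fin l) ℝ}
  {Q : Matrix (Fin n) (Fin n) ℝ} {R : Matrix (Fin l) (Fin l) ℝ} {P : Matrix (Fin n) (Fin n) ℝ}
  {W : ℕ → Ω → EuclideanSpace ℝ (Fin n)} {X₀ : Ω → EuclideanSpace ℝ (Fin n)}
  {U : ℕ → Ω → EuclideanSpace ℝ (Fin l)}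

theorem memLp_state (hN : IsNoiseModel Pr W X₀) (hU : ∀ k, MemLp (U k) 2 Pr) (k : ℕ) :
    MemLp (state A B W X₀ U k) 2 Pr := by
  induction k with
  | zero => exact hN.memLp_initial
  | succ k ih =>
    exact ((memLp_toEuclideanLin A ih).add (memLp_toEuclideanLin B (hU k))).add (hN.memLp_noise k)

/-- The mean weighted deviation of the control from the optimal feedback law at time `k`. -/
noncomputable def excess (Pr : Measure Ω) (A : Matrix (Fin n) (Fin n) ℝ)
    (B : Matrix (Fin n) (Fin l) ℝ) (R : Matrix (Fin l) (Fin l) ℝ) (P : Matrix (Fin n) (Fin n) ℝ)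
    (W : ℕ → Ω → EuclideanSpace ℝ (Fin n)) (X₀ : Ω → EuclideanSpace ℝ (Fin n))
    (U : ℕ → Ω → EuclideanSpace ℝ (Fin l)) (k : ℕ) : ℝ :=
  ∫ ω, weightedSq (R + Bᵀ * P * B)
    (U k ω - Matrix.toEuclideanLin (gain A B R P) (state A B W X₀ U k ω)) ∂Pr

theorem memLp_deviation (hN : IsNoiseModel Pr W X₀) (hU : ∀ k, MemLp (U k) 2 Pr)
    (K : Matrix (Fin l) (Fin n) ℝ) (k : ℕ) :
    MemLp (fun ω => U k ω - Matrix.toEuclideanLin K (state A B W X₀ U k ω)) 2 Pr :=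
  (hU k).sub (memLp_toEuclideanLin K (memLp_state hN hU k))

theorem excess_nonneg (hR : R.PosDef) (hP : P.PosSemidef) (k : ℕ) :
    0 ≤ excess Pr A B R P W X₀ U k :=
  integral_nonneg fun _ => weightedSq_nonneg (posDef_add_transpose_mul_mul hR hP).posSemidef _

/-- Completion of the square is integrated pointwise. The noise `W k` is independent of `A X + B U`
and centred, so its contribution to the next value of `P` splits off. -/
theorem stageCost_eq [IsProbabilityMeasure Pr] (hR : R.PosDef) (hP : P.PosSemidef)
    (hric : SolvesRiccati A B Q R P) (hN : IsNoiseModel Pr W X₀)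
    (hU : ∀ k, MemLp (U k) 2 Pr ∧
      AEStronglyMeasurable[history (state A B W X₀ U) k] (U k) Pr) (k : ℕ) :
    stageCost Pr Q R (state A B W X₀ U k) (U k) =
      ∫ ω, weightedSq P (state A B W X₀ U k ω) ∂Pr -
        ∫ ω, weightedSq P (state A B W X₀ U (k + 1) ω) ∂Pr +
        ∫ ω, weightedSq P (W k ω) ∂Pr + excess Pr A B R P W X₀ U k := by
  have hUm := fun k => (hU k).1
  have hUh := fun k => (hU k).2
  have hX := memLp_state (A := A) (B := B) hN hUm k
  have hY : MemLp (fun ω => Matrix.toEuclideanLin A (state A B W X₀ U k ω) +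
      Matrix.toEuclideanLin B (U k ω)) 2 Pr :=
    (memLp_toEuclideanLin A hX).add (memLp_toEuclideanLin B (hUm k))
  have hYm : AEStronglyMeasurable[noiseHistory W X₀ k] (fun ω =>
      Matrix.toEuclideanLin A (state A B W X₀ U k ω) + Matrix.toEuclideanLin B (U k ω)) Pr :=
    ((LinearMap.continuous_of_finiteDimensional
      (Matrix.toEuclideanLin A)).comp_aestronglyMeasurable
        (aestronglyMeasurable_state_of_history hUh k)).add
    ((LinearMap.continuous_of_finiteDimensional
      (Matrix.toEuclideanLin B)).comp_aestronglyMeasurable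
        (aestronglyMeasurable_control_of_history hUh k))
  have hind := indepFun_of_aestronglyMeasurable_noiseHistory hN.measurable_noise
    hN.iIndepFun_noise hN.measurable_initial hN.indepFun_initial hYm
  have hnext := integral_weightedSq_add_of_indepFun hP.isHermitian hY (hN.memLp_noise k) hind
    (hN.integral_noise k)
  have hsq : ∀ ω, weightedSq Q (state A B W X₀ U k ω) + weightedSq R (U k ω) =
      weightedSq P (state A B W X₀ U k ω) -
        weightedSq P (Matrix.toEuclideanLin A (state A B W X₀ U k ω) +
          Matrix.toEuclideanLin B (U k ω)) +
        weightedSq (R + Bᵀ * P * B)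
          (U k ω - Matrix.toEuclideanLin (gain A B R P) (state A B W X₀ U k ω)) := by
    intro ω
    have := weightedSq_riccatiMap (A := A) (B := B) (Q := Q) hR hP (state A B W X₀ U k ω) (U k ω)
    rw [hric.eq_riccatiMap] at this
    linarith
  have hi1 := integrable_weightedSq P hX
  have hi2 := integrable_weightedSq P hY
  have hi3 := integrable_weightedSq (R + Bᵀ * P * B)
    (memLp_deviation (A := A) (B := B) hN hUm (gain A B R P) k)
  rw [stageCost]
  simp only [hsq]
  rw [integral_add (f := fun ω => weightedSq P (state A B W X₀ U k ω) -
        weightedSq P (Matrix.toEuclideanLin A (state A B W X₀ U k ω) +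
          Matrix.toEuclideanLin B (U k ω))) (hi1.sub hi2) hi3, integral_sub hi1 hi2, excess]
  simp only [state]
  rw [hnext]
  ring

/-- By telescoping, only the terminal value and the accumulated excess depend on the control. -/
theorem cost_eq [IsProbabilityMeasure Pr] (hR : R.PosDef) (hP : P.PosSemidef)
    (hric : SolvesRiccati A B Q R P) (hN : IsNoiseModel Pr W X₀)
    (hU : ∀ k, MemLp (U k) 2 Pr ∧
      AEStronglyMeasurable[history (state A B W X₀ U) k] (U k) Pr) (N : ℕ) :
    cost Pr A B Q R W X₀ N U =
      ∫ ω, weightedSq P (X₀ ω) ∂Pr - ∫ ω, weightedSq P (state A B W X₀ U N ω) ∂Pr +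
        ∑ k ∈ Finset.range N, ∫ ω, weightedSq P (W k ω) ∂Pr +
        ∑ k ∈ Finset.range N, excess Pr A B R P W X₀ U k := by
  induction N with
  | zero => simp [cost, state]
  | succ N ih =>
    rw [cost] at ih ⊢
    rw [Finset.sum_range_succ, ih, stageCost_eq hR hP hric hN hU, Finset.sum_range_succ,
      Finset.sum_range_succ]
    ring

theorem feedback_mem_admissible {K : Matrix (Fin l) (Fin n) ℝ}
    (hK : IsPowerStable (A + B * K)) (hN : IsNoiseModel Pr W X₀) :
    feedback A B K W X₀ ∈ admissible Pr A B W X₀ := by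
  have hcl : ∀ k, MemLp (closedLoop A B K W X₀ k) 2 Pr := by
    intro k
    induction k with
    | zero => exact hN.memLp_initial
    | succ k ih => exact (memLp_toEuclideanLin _ ih).add (hN.memLp_noise k)
  refine ⟨fun k => ⟨memLp_toEuclideanLin K (hcl k), ?_⟩, ?_⟩
  · rw [state_feedback]
    have h1 : Measurable fun p : Set.Iic k → EuclideanSpace ℝ (Fin n) => p ⟨k, le_refl k⟩ := by
      fun_prop
    have h2 : Measurable[history (closedLoop A B K W X₀) k] (closedLoop A B K W X₀ k) :=
      h1.comp (comap_measurable fun ω (j : Set.Iic k) => closedLoop A B K W X₀ j ω)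
    exact ((measurable_toEuclideanLin K).comp h2).stronglyMeasurable.aestronglyMeasurable
  · obtain ⟨C, ρ, hC, hρ, hρ1, hb⟩ := hK.exists_integral_norm_sq_le Pr
    obtain ⟨β, hβ⟩ := hN.bounded_noise
    have h1 : 0 < 1 - ρ := by linarith
    set a := ∫ ω, ‖X₀ ω‖ ^ 2 ∂Pr with ha
    have ha0 : 0 ≤ a := integral_nonneg fun _ => sq_nonneg _
    have hβ0 : 0 ≤ β := (integral_nonneg fun _ => sq_nonneg _).trans (hβ 0)
    -- Adding `a` to the noise bound places the initial moment below the fixed point of the scalar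
    -- recursion; the final `1` makes the bound strictly positive.
    refine ⟨C * ((β + a) / (1 - ρ)) + 1, by positivity, fun k => ?_⟩
    rw [state_feedback]
    have h2 := hb (closedLoop A B K W X₀) W (hcl 0) hN.memLp_noise (fun _ _ => rfl) k
    have h3 : scalarRec ρ a (fun j => ∫ ω, ‖W j ω‖ ^ 2 ∂Pr) k ≤ (β + a) / (1 - ρ) := by
      refine scalarRec_le_of_le hρ hρ1 ?_ (fun j => (hβ j).trans (by linarith)) k
      rw [le_div_iff₀ h1]
      nlinarith
    have h4 := mul_le_mul_of_nonneg_left h3 hC.le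
    exact h2.trans (h4.trans (by linarith))

theorem sameControl_feedback_of_excess_eq_zero (hR : R.PosDef) (hP : P.PosSemidef)
    (hN : IsNoiseModel Pr W X₀) (hU : ∀ k, MemLp (U k) 2 Pr)
    (h : ∀ k, excess Pr A B R P W X₀ U k = 0) :
    SameControl Pr U (feedback A B (gain A B R P) W X₀) := by
  have hS := posDef_add_transpose_mul_mul (B := B) hR hP
  have hdev : ∀ k, ∀ᵐ ω ∂Pr,
      U k ω - Matrix.toEuclideanLin (gain A B R P) (state A B W X₀ U k ω) = 0 := by
    intro k
    have h0 := (integral_eq_zero_iff_of_nonneg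
      (fun _ => weightedSq_nonneg hS.posSemidef _)
      (integrable_weightedSq _ (memLp_deviation (A := A) (B := B) hN hU (gain A B R P) k))).mp (h k)
    filter_upwards [h0] with ω hω
    by_contra hne
    exact (weightedSq_pos hS hne).ne' hω
  -- The control agrees with the feedback of its own state; induction shows that this state is the
  -- closed-loop one.
  have hstate : ∀ k, ∀ᵐ ω ∂Pr, state A B W X₀ U k ω -
      closedLoop A B (gain A B R P) W X₀ k ω = 0 := by
    intro k
    induction k with
    | zero => exact Filter.Eventually.of_forall fun ω => sub_self _
    | succ k ih =>
      filter_upwards [ih, hdev k] with ω h1 h2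
      rw [state_succ_sub_closedLoop_succ, h1, h2]
      simp
  intro k
  filter_upwards [hstate k, hdev k] with ω h1 h2
  rw [feedback, ← sub_eq_zero.mp h1]
  exact sub_eq_zero.mp h2

/-- A square summable deviation from a stabilizing feedback law has a vanishing effect on the
state. -/
theorem tendsto_integral_norm_sq_state_sub_closedLoop (hR : R.PosDef) (hP : P.PosSemidef)
    (hK : IsPowerStable (A + B * gain A B R P)) (hN : IsNoiseModel Pr W X₀)
    (hU : ∀ k, MemLp (U k) 2 Pr) (hs : Summable (excess Pr A B R P W X₀ U)) :
    Filter.Tendsto (fun k => ∫ ω, ‖state A B W X₀ U k ω -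
      closedLoop A B (gain A B R P) W X₀ k ω‖ ^ 2 ∂Pr) Filter.atTop (nhds 0) := by
  have hS := posDef_add_transpose_mul_mul (B := B) hR hP
  obtain ⟨r, hr, hSr⟩ := exists_le_weightedSq hS
  obtain ⟨b, hb, hBb⟩ := exists_norm_toEuclideanLin_le B
  obtain ⟨C, ρ, hC, hρ, hρ1, hbound⟩ := hK.exists_integral_norm_sq_le Pr
  set K := gain A B R P with hKdef
  set w : ℕ → Ω → EuclideanSpace ℝ (Fin n) := fun k ω =>
    Matrix.toEuclideanLin B (U k ω - Matrix.toEuclideanLin K (state A B W X₀ U k ω)) with hw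
  have hdev := memLp_deviation (A := A) (B := B) hN hU K
  have hwm : ∀ k, MemLp (w k) 2 Pr := fun k => memLp_toEuclideanLin B (hdev k)
  have hwle : ∀ k, ∫ ω, ‖w k ω‖ ^ 2 ∂Pr ≤ b ^ 2 * r⁻¹ * excess Pr A B R P W X₀ U k := by
    intro k
    rw [excess, ← integral_const_mul]
    refine integral_mono (integrable_norm_sq (hwm k))
      ((integrable_weightedSq _ (hdev k)).const_mul _) fun ω => ?_
    calc ‖w k ω‖ ^ 2
        ≤ (b * ‖U k ω - Matrix.toEuclideanLin K (state A B W X₀ U k ω)‖) ^ 2 := by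
          gcongr; exact hBb _
      _ = b ^ 2 * r⁻¹ *
          (r * ‖U k ω - Matrix.toEuclideanLin K (state A B W X₀ U k ω)‖ ^ 2) := by
          field_simp
      _ ≤ _ := by gcongr; exact hSr _
  have hw0 : ∀ k, 0 ≤ ∫ ω, ‖w k ω‖ ^ 2 ∂Pr := fun k => integral_nonneg fun _ => sq_nonneg _
  have hd0 : ∀ ω, state A B W X₀ U 0 ω - closedLoop A B K W X₀ 0 ω = 0 := fun ω => sub_self _
  have hle := hbound (fun k ω => state A B W X₀ U k ω - closedLoop A B K W X₀ k ω) w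
    (by simp only [hd0]; exact MemLp.zero) hwm
    (state_succ_sub_closedLoop_succ A B K W X₀ U)
  simp only [hd0] at hle
  have ha0 : ∫ _ω : Ω, ‖(0 : EuclideanSpace ℝ (Fin n))‖ ^ 2 ∂Pr = 0 := by simp
  rw [ha0] at hle
  -- The state difference starts at `0` and its inputs have summable energy, so the comparison
  -- sequence is summable and tends to `0`.
  have hsum : Summable fun k => scalarRec ρ 0 (fun j => ∫ ω, ‖w j ω‖ ^ 2 ∂Pr) k := by
    refine summable_of_sum_range_le (c := (1 - ρ)⁻¹ * (0 + b ^ 2 * r⁻¹ *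
      ∑' k, excess Pr A B R P W X₀ U k)) (scalarRec_nonneg hρ le_rfl hw0) fun N => ?_
    refine (sum_scalarRec_le hρ hρ1 le_rfl hw0 N).trans ?_
    have h1 : 0 ≤ 1 - ρ := by linarith
    gcongr
    calc _ ≤ ∑ k ∈ Finset.range N, b ^ 2 * r⁻¹ * excess Pr A B R P W X₀ U k :=
          Finset.sum_le_sum fun k _ => hwle k
      _ ≤ _ := by
          rw [← Finset.mul_sum]
          gcongr
          exact hs.sum_le_tsum _ fun k _ => excess_nonneg hR hP k
  have hlim := hsum.tendsto_atTop_zero.const_mul C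
  rw [mul_zero] at hlim
  exact squeeze_zero (fun k => integral_nonneg fun _ => sq_nonneg _) hle hlim

/-- Here `v` stands for the excess, `a` and `b` for the terminal values of the competitor and of the
feedback, and `δ` for a bound on their state difference. The parameter `t` must be free: it is fixed
first to make `t * b N` small, and `δ N → 0` then absorbs the large factor `1 + t⁻¹`. -/
theorem exists_pos_eventually_lt_sum_add_sub {v a b δ : ℕ → ℝ} {α β : ℝ} (hv : ∀ k, 0 ≤ v k)
    {k₀ : ℕ} (hk₀ : 0 < v k₀) (ha : ∀ N, a N ≤ α) (hb0 : ∀ N, 0 ≤ b N) (hb : ∀ N, b N ≤ β)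
    (hab : ∀ t : ℝ, 0 < t → ∀ N, a N ≤ (1 + t) * b N + (1 + t⁻¹) * δ N)
    (hδ : Summable v → Filter.Tendsto δ Filter.atTop (nhds 0)) :
    ∃ N₀ : ℕ, ∃ ε : ℝ, 0 < ε ∧ ∀ N, N₀ ≤ N → ε < ∑ k ∈ Finset.range N, v k + b N - a N := by
  by_cases hs : Summable v
  · have hβ : 0 ≤ β := (hb0 0).trans (hb 0)
    -- The terms `t * b N` and `(1 + t⁻¹) * δ N` each cost at most a quarter of `v k₀`, so more than
    -- the margin `v k₀ / 4` survives. The `+ 1` guards against `β = 0`.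
    set t := v k₀ / (4 * (β + 1)) with ht
    have ht0 : 0 < t := by positivity
    have htβ : t * β ≤ v k₀ / 4 := by
      rw [ht, div_mul_eq_mul_div, div_le_div_iff₀ (by positivity) (by norm_num)]
      nlinarith
    have hlim := (hδ hs).const_mul (1 + t⁻¹)
    rw [mul_zero] at hlim
    have hsmall : ∀ᶠ N in Filter.atTop, (1 + t⁻¹) * δ N < v k₀ / 4 :=
      hlim.eventually_lt_const (by positivity)
    obtain ⟨N₁, hN₁⟩ := Filter.eventually_atTop.mp hsmall
    refine ⟨max N₁ (k₀ + 1), v k₀ / 4, by positivity, fun N hN => ?_⟩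
    have h1 := hN₁ N ((le_max_left _ _).trans hN)
    have h2 : v k₀ ≤ ∑ k ∈ Finset.range N, v k :=
      Finset.single_le_sum (f := v) (fun k _ => hv k) (Finset.mem_range.mpr
        (Nat.lt_of_succ_le ((le_max_right _ _).trans hN)))
    have h3 := hab t ht0 N
    have h4 : t * b N ≤ t * β := by gcongr; exact hb N
    linarith
  -- The diverging sum eventually exceeds `α + 1`, which beats the terminal value `a N ≤ α` with
  -- margin `1`.
  · have hlim := (not_summable_iff_tendsto_nat_atTop_of_nonneg hv).mp hs
    obtain ⟨N₁, hN₁⟩ := Filter.eventually_atTop.mp (hlim.eventually_gt_atTop (α + 1))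
    exact ⟨N₁, 1, one_pos, fun N hN => by linarith [hN₁ N hN, ha N, hb0 N]⟩

/-- The stabilizing feedback law beats every other admissible control by a fixed margin. -/
theorem exists_cost_feedback_add_lt [IsProbabilityMeasure Pr] (hR : R.PosDef) (hP : P.PosSemidef)
    (hric : SolvesRiccati A B Q R P) (hK : IsPowerStable (A + B * gain A B R P))
    (hN : IsNoiseModel Pr W X₀) (hU : U ∈ admissible Pr A B W X₀)
    (hne : ¬ SameControl Pr U (feedback A B (gain A B R P) W X₀)) :
    ∃ N₀ : ℕ, ∃ ε : ℝ, 0 < ε ∧ ∀ N, N₀ ≤ N →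
      cost Pr A B Q R W X₀ N (feedback A B (gain A B R P) W X₀) + ε <
        cost Pr A B Q R W X₀ N U := by
  set K := gain A B R P with hKdef
  have hV := feedback_mem_admissible hK hN
  have hUm := fun k => (hU.1 k).1
  have hVm := fun k => (hV.1 k).1
  obtain ⟨α, -, hα⟩ := hU.2
  obtain ⟨β, -, hβ⟩ := hV.2
  obtain ⟨p, hp, hPp⟩ := exists_abs_weightedSq_le P
  have hbnd : ∀ {V : ℕ → Ω → EuclideanSpace ℝ (Fin l)} {γ : ℝ}, (∀ k, MemLp (V k) 2 Pr) →
      (∀ k, ∫ ω, ‖state A B W X₀ V k ω‖ ^ 2 ∂Pr ≤ γ) →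
      ∀ N, ∫ ω, weightedSq P (state A B W X₀ V N ω) ∂Pr ≤ p * γ := by
    intro V γ hVm hγ N
    exact (integral_weightedSq_le hPp (memLp_state hN hVm N)).trans (by gcongr; exact hγ N)
  have hexU : ∃ k₀, 0 < excess Pr A B R P W X₀ U k₀ := by
    by_contra! hall
    exact hne (sameControl_feedback_of_excess_eq_zero hR hP hN hUm fun k =>
      le_antisymm (hall k) (excess_nonneg hR hP k))
  obtain ⟨k₀, hk₀⟩ := hexU
  have hexV : ∀ k, excess Pr A B R P W X₀ (feedback A B K W X₀) k = 0 := by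
    intro k
    simp only [excess, ← hKdef, ← feedback_eq, sub_self]
    simp [weightedSq]
  have hdiff : ∀ N, MemLp (fun ω => state A B W X₀ U N ω - closedLoop A B K W X₀ N ω) 2 Pr := by
    intro N
    rw [← state_feedback]
    exact (memLp_state hN hUm N).sub (memLp_state hN hVm N)
  -- Young's inequality for the competitor's state written as closed-loop state plus difference.
  have hyoung : ∀ t : ℝ, 0 < t → ∀ N, ∫ ω, weightedSq P (state A B W X₀ U N ω) ∂Pr ≤
      (1 + t) * ∫ ω, weightedSq P (state A B W X₀ (feedback A B K W X₀) N ω) ∂Pr +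
        (1 + t⁻¹) * (p * ∫ ω, ‖state A B W X₀ U N ω - closedLoop A B K W X₀ N ω‖ ^ 2 ∂Pr) := by
    intro t ht N
    have hcl := memLp_state (A := A) (B := B) hN hVm N
    have h1 := integral_weightedSq_le hPp (hdiff N)
    have h2 : 0 < 1 + t⁻¹ := by positivity
    refine le_trans ?_ (add_le_add_right (mul_le_mul_of_nonneg_left h1 h2.le) _)
    rw [← integral_const_mul, ← integral_const_mul, ← integral_add
      ((integrable_weightedSq P hcl).const_mul _) ((integrable_weightedSq P (hdiff N)).const_mul _)]
    refine integral_mono (integrable_weightedSq P (memLp_state hN hUm N))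
      (((integrable_weightedSq P hcl).const_mul _).add
        ((integrable_weightedSq P (hdiff N)).const_mul _)) fun ω => ?_
    have := weightedSq_add_le hP ht (closedLoop A B K W X₀ N ω)
      (state A B W X₀ U N ω - closedLoop A B K W X₀ N ω)
    rw [add_sub_cancel] at this
    simpa only [state_feedback] using this
  obtain ⟨N₀, ε, hε, hgap⟩ := exists_pos_eventually_lt_sum_add_sub (excess_nonneg hR hP) hk₀
    (hbnd hUm hα) (fun N => integral_nonneg fun _ => weightedSq_nonneg hP _) (hbnd hVm hβ) hyoung
    (fun hs => by
      simpa using (tendsto_integral_norm_sq_state_sub_closedLoop hR hP hK hN hUm hs).const_mul p)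
  refine ⟨N₀, ε, hε, fun N hNN => ?_⟩
  rw [cost_eq hR hP hric hN hU.1, cost_eq hR hP hric hN hV.1]
  simp only [hexV, Finset.sum_const_zero]
  linarith [hgap N hNN]

end Cost

end StochasticLQ

/-! ### Existence and uniqueness of the overtaking optimal control -/

theorem mainTheorem1 {n l : ℕ}
    (A : Matrix (Fin n) (Fin n) ℝ) (B : Matrix (Fin n) (Fin l) ℝ)
    (Q : Matrix (Fin n) (Fin n) ℝ) (R : Matrix (Fin l) (Fin l) ℝ)
    (hAB : StochasticLQ.IsStabilizable A B)
    (hQ : Q.PosSemidef) (hR : R.PosDef)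
    (hAQ : StochasticLQ.IsDetectable A (CFC.sqrt Q))
    {Ω : Type*} [MeasurableSpace Ω] (Pr : Measure Ω) [IsProbabilityMeasure Pr]
    (W : ℕ → Ω → EuclideanSpace ℝ (Fin n)) (hW : ∀ k, Measurable (W k))
    (covW : Matrix (Fin n) (Fin n) ℝ) (hcovW : covW.PosSemidef)
    (hWlaw : ∀ k, HasLaw (W k) (multivariateGaussian 0 covW) Pr)
    (hWindep : iIndepFun W Pr) :
    ∃ P : Matrix (Fin n) (Fin n) ℝ,
      P.PosSemidef ∧ StochasticLQ.SolvesRiccati A B Q R P ∧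
      (∀ P' : Matrix (Fin n) (Fin n) ℝ,
        P'.PosSemidef → StochasticLQ.SolvesRiccati A B Q R P' → P' = P) ∧
      (StochasticLQ.IsObservable A (CFC.sqrt Q) → P.PosDef) ∧
      ∀ (μ₀ : EuclideanSpace ℝ (Fin n)) (cov₀ : Matrix (Fin n) (Fin n) ℝ)
        (X₀ : Ω → EuclideanSpace ℝ (Fin n)),
        cov₀.PosSemidef → Measurable X₀ →
        HasLaw X₀ (multivariateGaussian μ₀ cov₀) Pr →
        IndepFun X₀ (fun ω k => W k ω) Pr →
        ∃ Ustar : ℕ → Ω → EuclideanSpace ℝ (Fin l),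
          (∀ k ω, Ustar k ω = Matrix.toEuclideanLin (StochasticLQ.gain A B R P)
            (StochasticLQ.state A B W X₀ Ustar k ω)) ∧
          StochasticLQ.IsOvertakingOptimal Pr (StochasticLQ.cost Pr A B Q R W X₀)
            (StochasticLQ.admissible Pr A B W X₀) Ustar ∧
          (∀ U, StochasticLQ.IsOvertakingOptimal Pr (StochasticLQ.cost Pr A B Q R W X₀)
            (StochasticLQ.admissible Pr A B W X₀) U → StochasticLQ.SameControl Pr U Ustar) ∧
          ∀ U ∈ StochasticLQ.admissible Pr A B W X₀, ¬ StochasticLQ.SameControl Pr U Ustar →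
            ∃ N₀ : ℕ, ∃ ε : ℝ, 0 < ε ∧ ∀ N : ℕ, N₀ ≤ N →
              StochasticLQ.cost Pr A B Q R W X₀ N Ustar + ε <
                StochasticLQ.cost Pr A B Q R W X₀ N U := by
  obtain ⟨P, hP, hric⟩ := StochasticLQ.exists_solvesRiccati hAB hQ hR
  have hK := hric.isPowerStable hQ hR hAQ hP
  refine ⟨P, hP, hric, fun P' hP' hric' => hric'.unique hQ hR hAQ hP' hP hric,
    hric.posDef hQ hR hP, fun μ₀ cov₀ X₀ _ hX₀ hX₀law hX₀W => ?_⟩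
  have hN := StochasticLQ.isNoiseModel_of_gaussian hW hWlaw hWindep hX₀ hX₀law hX₀W
  have hmem := StochasticLQ.feedback_mem_admissible hK hN
  have hgap := fun U (hU : U ∈ StochasticLQ.admissible Pr A B W X₀) hne =>
    StochasticLQ.exists_cost_feedback_add_lt hR hP hric hK hN hU hne
  have hover : ∀ U ∈ StochasticLQ.admissible Pr A B W X₀,
      ¬ StochasticLQ.SameControl Pr U
        (StochasticLQ.feedback A B (StochasticLQ.gain A B R P) W X₀) →
      StochasticLQ.Overtakes (StochasticLQ.cost Pr A B Q R W X₀)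
        (StochasticLQ.feedback A B (StochasticLQ.gain A B R P) W X₀) U := by
    intro U hU hne
    obtain ⟨N₀, ε, hε, h⟩ := hgap U hU hne
    exact ⟨N₀, fun N hNN => by linarith [h N hNN.le]⟩
  refine ⟨StochasticLQ.feedback A B (StochasticLQ.gain A B R P) W X₀,
    StochasticLQ.feedback_eq A B _ W X₀, ⟨hmem, hover⟩, fun U hU => ?_, hgap⟩
  by_contra hne
  obtain ⟨N₁, h₁⟩ := hover U hU.1 hne
  obtain ⟨N₂, h₂⟩ := hU.2 _ hmem fun h => hne fun k => (h k).symm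
  -- Beyond both thresholds the two controls would have to be strictly cheaper than each other.
  have hlt₁ := h₁ (max N₁ N₂ + 1) (by omega)
  have hlt₂ := h₂ (max N₁ N₂ + 1) (by omega)
  exact lt_asymm hlt₁ hlt₂
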